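/- Let $b\ge 2$, $s\ge 1$, $n\ge 1$ be integers, $\mathbb Z_b=\mathbb Z/b\mathbb Z$ (identified with $\{0,\dots,b-1\}$ where digits are meant), and let $G=\mathbb Z_b^{s\times n}$ be the additive group of $s\times n$ matrices over $\mathbb Z_b$. For $X=(x_{i,j})\in G$ put $I_n(X)=\prod_{i=1}^s\big[\sum_{j=1}^n x_{i,j}b^{-j},\ \sum_{j=1}^n x_{i,j}b^{-j}+b^{-n}\big)$, and for an integrable function $f$ on the unit cube let $f_n(X)=\mathrm{Vol}(I_n(X))^{-1}\int_{I_n(X)}f(\boldsymbol x)\,d\boldsymbol x$. For a subgroup $P\subset G$ and $\sigma\in G$ let $I_{P+\sigma}(f_n)=|P|^{-1}\sum_{X\in P+\sigma}f_n(X)$, and let $\mathrm{Var}_{\sigma\in G}$ be the variance for $\sigma$ uniformly distributed on $G$. For $A,B\in G$ put $A\bullet B=\exp\big(\tfrac{2\pi \sqrt{-1}}{b}\sum_{i,j}a_{i,j}b_{i,j}\big)$, $\widehat{f_n}(A)=|G|^{-1}\sum_{B\in G}f_n(B)\,(A\bullet B)$ and $P^\perp=\{A\in G: A\bullet B=1\text{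 for all }B\in P\}$. Let $\mu(A)=\sum_{i,j:\,a_{i,j}\ne0}j$ (Dick weight), $h(A)=|\{(i,j):a_{i,j}\neq 0\}|$ (Hamming weight) and, for a weight $\nu$, $$\mathcal W(P;\nu)=\sqrt{\sum_{A\in P^\perp\setminus\{0\}}b^{-2\nu(A)}}.$$ Call $f:[0,1)^s\to\mathbb R$ $n$-smooth if $f$ and all its weak mixed derivatives $f^{(\tau)}$, $\tau\in\{0,\dots,n\}^s$, are square integrable on the unit cube, and put $$\|f\|_n^2=\sum_{\tau\in\{0,\dots,n\}^s}\int_{[0,1]^{v}}\Big(\int_{[0,1]^{v^c}}f^{(\tau)}(\boldsymbol x)\,d\boldsymbol x_{v^c}\Big)^2d\boldsymbol x_{v},\qquad v=\{i:\tau_i=n\},\quad v^c=\{1,\dots,s\}\setminus v.$$ (1) There is a constant $C_{b,s,n}$ depending only on $b,s,n$ such that, for every $n$-smooth $f$, $|\widehat{f_n}(A)|\le C_{b,s,n}\|f\|_n\,b^{-\mu(A)}$ for all $A\in G$, and, for every subgroup $P\subset G$, $$\sqrt{\mathrm{Var}_{\sigma\in G}[I_{P+\sigma}(f_n)]}\le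 C_{b,s,n}\,\|f\|_n\,\mathcal W(P;\mu).$$ (2) Suppose $b=2$, and let $f:[0,1]^s\to\mathbb R$ be such that the mixed partial derivatives $f^{(\boldsymbol N)}=(\partial/\partial x_1)^{N_1}\cdots(\partial/\partial x_s)^{N_s}f$ exist and are continuous on $[0,1]^s$ (one-sided at the boundary) for all $\boldsymbol N=(N_1,\dots,N_s)$ with $0\le N_i\le n$. Then for every subgroup $P\subset G$ $$\sqrt{\mathrm{Var}_{\sigma\in G}[I_{P+\sigma}(f_n)]}\le\Big(\max_{\substack{0\le N_i\le n\ (1\le i\le s)\\ \boldsymbol N\ne0}}\ \sup_{[0,1]^s}|f^{(\boldsymbol N)}|\Big)\,\mathcal W(P;\mu+h).$$ -/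

import Mathlib

open MeasureTheory
open scoped ContDiff

noncomputable section

namespace DigitalNet

/-! ## Quasi-Monte Carlo integration over a finite abelian group -/

/-- The average `I_P(F) = |P|⁻¹ ∑_{g ∈ P} F(g)` of `F` over a point set `P`. -/
def qmcAverage {G : Type*} (P : Set G) (F : G → ℝ) : ℝ :=
  (Nat.card P : ℝ)⁻¹ * ∑ᶠ g ∈ P, F g

/-- The digitally shifted point set `P + σ = {g + σ | g ∈ P}`. -/
def shifted {G : Type*} [Add G] (P : Set G) (σ : G) : Set G :=
  (fun g => g + σ) '' P

/-- The mean of `Y(σ)` for `σ` uniformly distributed on `G`. -/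
def unifMean {G : Type*} [Fintype G] (Y : G → ℝ) : ℝ :=
  (Fintype.card G : ℝ)⁻¹ * ∑ σ, Y σ

/-- The variance of `Y(σ)` for `σ` uniformly distributed on `G`. -/
def unifVariance {G : Type*} [Fintype G] (Y : G → ℝ) : ℝ :=
  unifMean (fun σ => (Y σ - unifMean Y) ^ 2)

/-! ## Digit matrices, the dual net, weights and figures of merit -/

/-- The group `ℤ_b^{s × n}`.  The column with index `j : Fin n` (from `0` to `n - 1`) carries the
digit with number `j + 1`. -/
abbrev DigitMatrix (b s n : ℕ) : Type := Matrix (Fin s) (Fin n) (ZMod b)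

section

variable {b s n : ℕ}

/-- The pairing `A • B = ω_b ^ (∑ a_{ij} b_{ij})`, `ω_b = exp(2πi/b)`, that identifies
`ℤ_b^{s × n}` with its character group. -/
def pairing [NeZero b] (A B : DigitMatrix b s n) : ℂ :=
  ZMod.stdAddChar (∑ i, ∑ j, A i j * B i j)

/-- The dual net `P^⊥`. -/
def dualNet [NeZero b] (P : AddSubgroup (DigitMatrix b s n)) : Set (DigitMatrix b s n) :=
  {A | ∀ B ∈ P, pairing A B = 1}

/-- The discrete Fourier coefficient of `F` at `A`. -/
def fourierCoeff [NeZero b] (F : DigitMatrix b s n → ℝ) (A : DigitMatrix b s n) : ℂ :=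
  (Fintype.card (DigitMatrix b s n) : ℂ)⁻¹ * ∑ B, (F B : ℂ) * pairing A B

/-- The Dick weight `μ(A) = ∑ j δ(a_{ij})`, with `j` running from `1` to `n`. -/
def dickWeight (A : DigitMatrix b s n) : ℕ :=
  ∑ i, ∑ j : Fin n, if A i j = 0 then 0 else (j : ℕ) + 1

/-- The Hamming weight `h(A) = ∑ δ(a_{ij})`. -/
def hammingWeight (A : DigitMatrix b s n) : ℕ :=
  ∑ i, ∑ j : Fin n, if A i j = 0 then 0 else 1

/-- The Walsh figure of merit for the root mean square error, for a weight `ν`: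
`W(P; ν) = (∑_{A ∈ P^⊥ ∖ {0}} b ^ (-2 ν(A))) ^ (1/2)`. -/
def walshMerit [NeZero b] (P : AddSubgroup (DigitMatrix b s n))
    (ν : DigitMatrix b s n → ℕ) : ℝ :=
  Real.sqrt (∑ᶠ A ∈ dualNet P \ {0}, ((b : ℝ) ^ (2 * ν A))⁻¹)

/-! ## The discretization -/

/-- The point `ψ(X)`, with coordinates `∑_{j=1}^n x_{ij} b^{-j}`. -/
def digitPoint (X : DigitMatrix b s n) : Fin s → ℝ :=
  fun i => ∑ j : Fin n, ((X i j).val : ℝ) * ((b : ℝ) ^ ((j : ℕ) + 1))⁻¹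

/-- The box `I_n(X) = ∏_i [ψ(X)_i, ψ(X)_i + b^{-n})`. -/
def digitBox (X : DigitMatrix b s n) : Set (Fin s → ℝ) :=
  Set.univ.pi fun i => Set.Ico (digitPoint X i) (digitPoint X i + ((b : ℝ) ^ n)⁻¹)

/-- The `n`-digit discretization `f_n`: the mean value of `f` over the boxes `I_n(X)`. -/
def discretization (f : (Fin s → ℝ) → ℝ) (X : DigitMatrix b s n) : ℝ :=
  (volume.real (digitBox X))⁻¹ * ∫ x in digitBox X, f x

/-- The standard deviation of `I_{P+σ}(f_n)` over a uniformly distributed digital shift `σ`. -/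
def rmsError [NeZero b] (P : AddSubgroup (DigitMatrix b s n)) (f : (Fin s → ℝ) → ℝ) : ℝ :=
  Real.sqrt (unifVariance fun σ : DigitMatrix b s n =>
    qmcAverage (shifted (P : Set (DigitMatrix b s n)) σ) (discretization f))

end

/-! ## The Sobolev space of functions with square integrable mixed derivatives -/

/-- The open unit cube. -/
def openCube (ι : Type*) : Set (ι → ℝ) := Set.univ.pi fun _ => Set.Ioo 0 1

/-- The mixed partial derivative `(∂/∂x_1)^{τ_1} ⋯ (∂/∂x_s)^{τ_s} φ` of a smooth function. -/
def smoothPartial {s : ℕ} (τ : Fin s → ℕ) (φ : (Fin s → ℝ) → ℝ) : (Fin s → ℝ) → ℝ :=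
  (List.finRange s).foldr
    (fun i g => (fun u x => fderiv ℝ u x (Pi.single i 1))^[τ i] g) φ

/-- `g` is a square integrable weak derivative `f^{(τ)}` of `f` on the open unit cube. -/
def IsWeakDeriv {s : ℕ} (τ : Fin s → ℕ) (f g : (Fin s → ℝ) → ℝ) : Prop :=
  MemLp g 2 (volume.restrict (openCube (Fin s))) ∧
  ∀ φ : (Fin s → ℝ) → ℝ, ContDiff ℝ ∞ φ → HasCompactSupport φ →
    tsupport φ ⊆ openCube (Fin s) →
    ∫ x in openCube (Fin s), f x * smoothPartial τ φ x =
      (-1) ^ (∑ i, τ i) * ∫ x in openCube (Fin s), g x * φ x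

/-- `f` is `n`-smooth: it is square integrable on the unit cube and has square integrable mixed
weak derivatives up to order `n` in each variable. -/
def IsNSmooth {s : ℕ} (n : ℕ) (f : (Fin s → ℝ) → ℝ) : Prop :=
  MemLp f 2 (volume.restrict (openCube (Fin s))) ∧
  ∀ τ : Fin s → ℕ, (∀ i, τ i ≤ n) → ∃ g, IsWeakDeriv τ f g

open Classical in
/-- The weak derivative `f^{(τ)}` (unique almost everywhere on the unit cube; `0` if there is
none). -/
def weakDeriv {s : ℕ} (τ : Fin s → ℕ) (f : (Fin s → ℝ) → ℝ) : (Fin s → ℝ) → ℝ :=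
  if h : ∃ g, IsWeakDeriv τ f g then h.choose else 0

/-- The norm `‖f‖_n`, where
`‖f‖_n² = ∑_{τ ∈ {0,…,n}^s} ∫_{[0,1]^v} (∫_{[0,1]^{v^c}} f^{(τ)}(x) dx_{v^c})² dx_v` with
`v = {i | τ_i = n}`.  This is the sum over `v ⊆ u ⊆ {1,…,s}` and `τ ∈ {1,…,n-1}^{u ∖ v}` of the
terms for the multi-index that is `n` on `v`, `τ` on `u ∖ v` and `0` outside `u`. -/
def smoothNorm {s : ℕ} (n : ℕ) (f : (Fin s → ℝ) → ℝ) : ℝ :=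
  Real.sqrt (∑ τ : Fin s → Fin (n + 1),
    ∫ y in openCube {i // (τ i : ℕ) = n},
      (∫ z in openCube {i // ¬ (τ i : ℕ) = n},
        weakDeriv (fun i => (τ i : ℕ)) f
          (fun i => if h : (τ i : ℕ) = n then y ⟨i, h⟩ else z ⟨i, h⟩)) ^ 2)

/-! ## Classical mixed partial derivatives on the closed unit cube -/

/-- The mixed partial derivative `f^{(N)} = (∂/∂x_1)^{N_1} ⋯ (∂/∂x_s)^{N_s} f` on `[0,1]^s`
(one-sided at the boundary). -/
def cubePartial {s : ℕ} (N : Fin s → ℕ) (f : (Fin s → ℝ) → ℝ) : (Fin s → ℝ) → ℝ :=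
  (List.finRange s).foldr
    (fun i g =>
      (fun u x => derivWithin (fun t => u (Function.update x i t)) (Set.Icc 0 1) (x i))^[N i] g) f

/-- All `f^{(N)}` with `0 ≤ N_i ≤ n` exist and are continuous on `[0,1]^s`.  The derivative
`∂/∂x_i` is applied to `f^{(N)}`, to form `f^{(N + e_i)}`, when `N_j = 0` for all `j < i`. -/
def HasContMixedPartials {s : ℕ} (n : ℕ) (f : (Fin s → ℝ) → ℝ) : Prop :=
  ∀ N : Fin s → ℕ, (∀ i, N i ≤ n) →
    ContinuousOn (cubePartial N f) (Set.Icc 0 1) ∧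
    ∀ i, N i < n → (∀ j < i, N j = 0) → ∀ x ∈ Set.Icc (0 : Fin s → ℝ) 1,
      DifferentiableWithinAt ℝ (fun t => cubePartial N f (Function.update x i t))
        (Set.Icc 0 1) (x i)

/-- The supremum norm on `[0,1]^s`. -/
def supNorm {s : ℕ} (g : (Fin s → ℝ) → ℝ) : ℝ :=
  ⨆ x : Set.Icc (0 : Fin s → ℝ) 1, |g x|

/-- The maximum of `‖f^{(N)}‖_∞` over the finitely many `N ≠ 0` with `0 ≤ N_i ≤ n`. -/
def maxPartialNorm {s : ℕ} (n : ℕ) (f : (Fin s → ℝ) → ℝ) : ℝ :=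
  ⨆ N : {N : Fin s → Fin (n + 1) // N ≠ 0}, supNorm (cubePartial (fun i => (N.1 i : ℕ)) f)

end DigitalNet

end

/-!
The Fourier coefficients of the discretization `f_n` are the Walsh coefficients of `f` on the unit
cube (`fourierCoeff_discretization`), and Parseval's identity on the digit group expresses the mean
square error of a randomly shifted rule as the sum of their squared absolute values over the nonzero
elements of the dual net (`rmsError_eq`).  Both parts therefore reduce to a bound on a single Walsh
coefficient (`rmsError_le`).

Such a coefficient is estimated by integration by parts in each coordinate.  The primitive of
`u - mean u` vanishes at both ends of the unit interval, so that, with `T = centeredPrimitive`,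
`∫ f u = (∫ f) (mean u) - ∫ f' (T u)`; repeating this gives averages of derivatives of order
less than `n`, with weights `mean (T^r u)`, and one integral of the `n`-th derivative against
`T^n u`.  These are exactly the terms in the norm.  When `u` is a Walsh function with `v` nonzero
digits, every application of `T` removes the last nonzero digit: if it has number `j`, the
remaining digits are constant on the `b`-adic intervals of length `b^(-(j - 1))`, and what is left
is periodic with that period and has mean zero, so its primitive gains a factor `b^(-(j - 1))`.
Hence the first `v` means vanish and `T^v u` has size `b^(v - μ)`
(`exists_iterate_centeredPrimitive`).  In base two, evenness of the periodic factor gives the sharp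
bound `2^(-(μ + v))` for the `L¹` norm of `T^v u`, and integrating by parts `v` times leaves a
single term (`norm_fourierCoeff_le_of_base_two`).

For weak derivatives, integration by parts against step functions follows from the definition by
density: both sides are linear and `L²`-bounded in each factor of a tensor product, and test
functions are dense in `L²` of the unit interval (`eq_zero_of_separately`,
`IsWeakPartial.tensorIntegral_eq`).  The classical case uses the same identity, since a
continuous partial derivative is a weak one.
-/

noncomputable section

namespace DigitalNet

/-! ### Fourier analysis on the digit group and the variance of a randomly shifted rule -/

section Fourier

variable {b s n : ℕ} [NeZero b]

lemma pairing_add_left (A A' B : DigitMatrix b s n) :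
    pairing (A + A') B = pairing A B * pairing A' B := by
  simp only [pairing, Matrix.add_apply, add_mul, Finset.sum_add_distrib, AddChar.map_add_eq_mul]

lemma pairing_comm (A B : DigitMatrix b s n) : pairing A B = pairing B A := by
  simp only [pairing, mul_comm]

lemma pairing_add_right (A B B' : DigitMatrix b s n) :
    pairing A (B + B') = pairing A B * pairing A B' := by
  simp only [pairing_comm A, pairing_add_left]

lemma pairing_zero_left (B : DigitMatrix b s n) : pairing 0 B = 1 := by
  simp [pairing]

lemma star_pairing (A B : DigitMatrix b s n) : star (pairing A B) = pairing A (-B) := by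
  simp only [pairing, Matrix.neg_apply, mul_neg, Finset.sum_neg_distrib, AddChar.map_neg_eq_conj]
  rfl

lemma sum_pairing_eq_zero {B : DigitMatrix b s n} (hB : B ≠ 0) :
    ∑ A : DigitMatrix b s n, pairing A B = 0 := by
  obtain ⟨i, j, hij⟩ : ∃ i j, B i j ≠ 0 := by
    by_contra! h
    exact hB (by ext i j; exact h i j)
  let A₀ : DigitMatrix b s n := Matrix.single i j 1
  have h1 : pairing A₀ B ≠ 1 := by
    have : ∑ i', ∑ j', A₀ i' j' * B i' j' = B i j := by
      rw [Finset.sum_eq_single i, Finset.sum_eq_single j]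
      · simp [A₀]
      · intro j' _ hj'; simp [A₀, hj'.symm]
      · simp
      · intro i' _ hi'; simp [A₀, hi'.symm]
      · simp
    rw [pairing, this]
    intro h
    apply hij
    apply ZMod.injective_stdAddChar
    rw [h, AddChar.map_zero_eq_one]
  have h2 : ∑ A : DigitMatrix b s n, pairing A B = pairing A₀ B * ∑ A, pairing A B := by
    rw [Finset.mul_sum, ← Equiv.sum_comp (Equiv.addLeft A₀)]
    simp [pairing_add_left]
  have h3 : (pairing A₀ B - 1) * ∑ A : DigitMatrix b s n, pairing A B = 0 := by
    rw [sub_mul, ← h2]; ring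
  exact (mul_eq_zero.mp h3).resolve_left (sub_ne_zero.mpr h1)

/-- Parseval's identity on the digit group. -/
lemma sum_normSq_fourierCoeff (F : DigitMatrix b s n → ℝ) :
    ∑ A, ‖fourierCoeff F A‖ ^ 2 = unifMean (fun B => F B ^ 2) := by
  set N : ℂ := (Fintype.card (DigitMatrix b s n) : ℂ) with hN
  have hN0 : N ≠ 0 := by simp [hN]
  have key : ∀ A, ((‖fourierCoeff F A‖ ^ 2 : ℝ) : ℂ) =
      N⁻¹ * N⁻¹ * ∑ B, ∑ B', (F B : ℂ) * F B' * pairing A (B - B') := by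
    intro A
    rw [Complex.ofReal_pow, ← Complex.mul_conj', fourierCoeff, map_mul, map_sum, map_inv₀,
      Complex.conj_natCast, ← hN, mul_mul_mul_comm, Finset.sum_mul_sum]
    congr 1
    refine Finset.sum_congr rfl fun B _ => Finset.sum_congr rfl fun B' _ => ?_
    have := star_pairing A B'
    rw [map_mul, Complex.conj_ofReal, sub_eq_add_neg, pairing_add_right, ← this]
    simp only [Complex.star_def]; ring
  have h : ((∑ A, ‖fourierCoeff F A‖ ^ 2 : ℝ) : ℂ) = ((unifMean (fun B => F B ^ 2) : ℝ) : ℂ) := by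
    rw [Complex.ofReal_sum, Finset.sum_congr rfl fun A _ => key A, ← Finset.mul_sum,
      Finset.sum_comm]
    have : ∀ B : DigitMatrix b s n, ∑ A : DigitMatrix b s n, ∑ B' : DigitMatrix b s n,
        (F B : ℂ) * F B' * pairing A (B - B') = N * (F B : ℂ) ^ 2 := by
      intro B
      rw [Finset.sum_comm, Finset.sum_eq_single B]
      · simp [pairing_comm _ (0 : DigitMatrix b s n), pairing_zero_left, hN]
        ring
      · intro B' _ hB'
        rw [← Finset.mul_sum, sum_pairing_eq_zero (sub_ne_zero.mpr hB'.symm), mul_zero]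
      · simp
    rw [Finset.sum_congr rfl fun B _ => this B, ← Finset.mul_sum, unifMean]
    push_cast
    rw [← hN]
    field_simp
  exact_mod_cast h

lemma fourierCoeff_zero (F : DigitMatrix b s n → ℝ) :
    fourierCoeff F 0 = ((unifMean F : ℝ) : ℂ) := by
  simp [fourierCoeff, pairing_zero_left, unifMean]

omit [NeZero b] in
lemma qmcAverage_shifted (P : AddSubgroup (DigitMatrix b s n)) (F : DigitMatrix b s n → ℝ)
    (σ : DigitMatrix b s n) :
    qmcAverage (shifted (P : Set (DigitMatrix b s n)) σ) F =
      (Nat.card P : ℝ)⁻¹ * ∑ᶠ g ∈ (P : Set (DigitMatrix b s n)), F (g + σ) := by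
  have hinj : Function.Injective (fun g : DigitMatrix b s n => g + σ) := add_left_injective σ
  rw [qmcAverage, shifted, Nat.card_image_of_injective hinj, finsum_mem_image hinj.injOn]
  rfl

/-- The mean of a character over `P` has absolute value one on the dual net and vanishes elsewhere. -/
lemma sum_pairing_subgroup (P : AddSubgroup (DigitMatrix b s n)) (A : DigitMatrix b s n) :
    ‖(Nat.card P : ℂ)⁻¹ * ∑ᶠ g ∈ (P : Set (DigitMatrix b s n)), pairing A (-g)‖ =
      (dualNet P).indicator 1 A := by
  classical
  have hP : (Nat.card P : ℂ) ≠ 0 := by simp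
  by_cases hA : A ∈ dualNet P
  · have : ∀ g ∈ (P : Set (DigitMatrix b s n)), pairing A (-g) = 1 :=
      fun g hg => hA _ (P.neg_mem hg)
    rw [finsum_mem_congr rfl this, Set.indicator_of_mem hA, finsum_mem_eq_toFinset_sum]
    have hc : (P : Set (DigitMatrix b s n)).toFinset.card = Nat.card P := by
      rw [Set.toFinset_card, Nat.card_eq_fintype_card]; rfl
    rw [Finset.sum_const, hc, nsmul_eq_mul, mul_one, inv_mul_cancel₀ hP]
    simp
  · rw [Set.indicator_of_notMem hA]
    simp only [dualNet, Set.mem_ofPred_eq, not_forall] at hA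
    obtain ⟨B, hB, hAB⟩ := hA
    have h2 : ∑ᶠ g ∈ (P : Set (DigitMatrix b s n)), pairing A (-g) =
        pairing A B * ∑ᶠ g ∈ (P : Set (DigitMatrix b s n)), pairing A (-g) := by
      rw [mul_finsum_mem]
      simp_rw [← pairing_add_right]
      refine finsum_mem_eq_of_bijOn (fun g => g + B) ⟨?_, ?_, ?_⟩ ?_
      · intro g hg; exact P.add_mem hg hB
      · exact (add_left_injective B).injOn
      · intro g hg; exact ⟨g - B, P.sub_mem hg hB, by simp⟩
      · intro g hg; congr 1; abel
    have h3 : (pairing A B - 1) * ∑ᶠ g ∈ (P : Set (DigitMatrix b s n)), pairing A (-g) = 0 := by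
      rw [sub_mul, ← h2]; ring
    rw [(mul_eq_zero.mp h3).resolve_left (sub_ne_zero.mpr hAB)]
    simp

lemma norm_fourierCoeff_qmcAverage (P : AddSubgroup (DigitMatrix b s n))
    (F : DigitMatrix b s n → ℝ) (A : DigitMatrix b s n) :
    ‖fourierCoeff (fun σ => qmcAverage (shifted (P : Set (DigitMatrix b s n)) σ) F) A‖ =
      (dualNet P).indicator (fun A => ‖fourierCoeff F A‖) A := by
  classical
  have h : fourierCoeff (fun σ => qmcAverage (shifted (P : Set (DigitMatrix b s n)) σ) F) A =
      ((Nat.card P : ℂ)⁻¹ * ∑ᶠ g ∈ (P : Set (DigitMatrix b s n)), pairing A (-g)) *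
        fourierCoeff F A := by
    simp only [fourierCoeff, qmcAverage_shifted]
    simp_rw [finsum_mem_eq_toFinset_sum]
    push_cast
    rw [Finset.mul_sum (s := (P : Set (DigitMatrix b s n)).toFinset) (f := fun g => pairing A (-g)),
      Finset.sum_mul]
    simp only [Finset.sum_mul, Finset.mul_sum]
    rw [Finset.sum_comm]
    refine Finset.sum_congr rfl fun g _ => ?_
    rw [← Equiv.sum_comp (Equiv.addRight g) (fun B => (Nat.card P : ℂ)⁻¹ * pairing A (-g) *
      ((Fintype.card (DigitMatrix b s n) : ℂ)⁻¹ * (F B * pairing A B)))]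
    refine Finset.sum_congr rfl fun B _ => ?_
    have : pairing A B = pairing A (-g) * pairing A (B + g) := by
      rw [← pairing_add_right]; congr 1; abel
    rw [this]
    simp only [Equiv.coe_addRight, add_comm g B]
    ring
  rw [h, norm_mul, sum_pairing_subgroup]
  by_cases hA : A ∈ dualNet P <;> simp [hA]

/-- The mean square error of a randomly shifted rule is the sum of the squared Fourier
coefficients over the nonzero elements of the dual net. -/
lemma rmsError_eq (P : AddSubgroup (DigitMatrix b s n)) (f : (Fin s → ℝ) → ℝ) :
    rmsError P f = Real.sqrt
      (∑ᶠ A ∈ dualNet P \ {0}, ‖fourierCoeff (discretization f) A‖ ^ 2) := by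
  classical
  set F := discretization (b := b) (n := n) f
  set Y : DigitMatrix b s n → ℝ := fun σ => qmcAverage (shifted (P : Set (DigitMatrix b s n)) σ) F
    with hY
  have hN0 : (Fintype.card (DigitMatrix b s n) : ℝ) ≠ 0 := by simp
  have hvar : unifVariance Y = unifMean (fun B => Y B ^ 2) - unifMean Y ^ 2 := by
    have : ∑ σ, (Y σ - unifMean Y) ^ 2 = ∑ σ, Y σ ^ 2 - 2 * unifMean Y * ∑ σ, Y σ +
        (Fintype.card (DigitMatrix b s n) : ℝ) * unifMean Y ^ 2 := by
      simp only [sub_sq, Finset.sum_add_distrib, Finset.sum_sub_distrib, Finset.mul_sum,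
        Finset.sum_const, Finset.card_univ, nsmul_eq_mul]
      congr 2
      exact Finset.sum_congr rfl fun _ _ => by ring
    have h2 : ∑ σ, Y σ = (Fintype.card (DigitMatrix b s n) : ℝ) * unifMean Y := by
      rw [unifMean]; field_simp
    rw [unifVariance, unifMean, this, h2]
    simp only [unifMean]
    field_simp
    ring
  have h0 : unifMean Y ^ 2 = ‖fourierCoeff Y 0‖ ^ 2 := by
    rw [fourierCoeff_zero, Complex.norm_real, Real.norm_eq_abs, sq_abs]
  rw [rmsError]
  change Real.sqrt (unifVariance Y) = _
  rw [hvar, h0, ← sum_normSq_fourierCoeff, ← Finset.add_sum_erase _ _ (Finset.mem_univ 0),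
    add_sub_cancel_left]
  congr 1
  simp_rw [hY, norm_fourierCoeff_qmcAverage]
  rw [finsum_mem_eq_toFinset_sum]
  have : ∀ A, ((dualNet P).indicator (fun A => ‖fourierCoeff F A‖) A) ^ 2 =
      if A ∈ dualNet P then ‖fourierCoeff F A‖ ^ 2 else 0 := by
    intro A; by_cases hA : A ∈ dualNet P <;> simp [hA]
  simp_rw [this]
  rw [← Finset.sum_filter]
  refine Finset.sum_congr ?_ fun _ _ => rfl
  ext A; simp [and_comm]

/-- A pointwise bound on the Fourier coefficients turns into a bound on the root mean square
error by the corresponding figure of merit. -/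
lemma rmsError_le {P : AddSubgroup (DigitMatrix b s n)} {f : (Fin s → ℝ) → ℝ} {K : ℝ}
    (hK : 0 ≤ K) {ν : DigitMatrix b s n → ℕ}
    (h : ∀ A : DigitMatrix b s n, A ≠ 0 →
      ‖fourierCoeff (discretization f) A‖ ≤ K * ((b : ℝ) ^ ν A)⁻¹) :
    rmsError P f ≤ K * walshMerit P ν := by
  classical
  rw [rmsError_eq, walshMerit]
  conv_rhs => rw [← Real.sqrt_sq hK, ← Real.sqrt_mul (sq_nonneg K)]
  apply Real.sqrt_le_sqrt
  rw [finsum_mem_eq_toFinset_sum, finsum_mem_eq_toFinset_sum, Finset.mul_sum]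
  refine Finset.sum_le_sum fun A hA => ?_
  have hA0 : A ≠ 0 := by simp at hA; exact hA.2
  calc ‖fourierCoeff (discretization f) A‖ ^ 2 ≤ (K * ((b : ℝ) ^ ν A)⁻¹) ^ 2 :=
        pow_le_pow_left₀ (norm_nonneg _) (h A hA0) 2
    _ = K ^ 2 * ((b : ℝ) ^ (2 * ν A))⁻¹ := by
        rw [mul_pow, inv_pow, ← pow_mul, mul_comm (ν A)]

end Fourier

/-! ### Fourier coefficients of the discretization as Walsh coefficients -/

section Walsh

variable {b s n : ℕ}

/-- The step function `t ↦ ω_b ^ (a ξ)`, where `ξ` is the digit of `t` with number `j + 1`.  As the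
digit is read off from `⌊b^(j+1) t⌋` modulo `b`, the function is `b^(-j)`-periodic on the real
line. -/
def digitChar [NeZero b] (j : ℕ) (a : ZMod b) (t : ℝ) : ℂ :=
  ZMod.stdAddChar (a * ((⌊(b : ℝ) ^ (j + 1) * t⌋ : ℤ) : ZMod b))

/-- The Walsh function with digit vector `a`. -/
def walsh [NeZero b] (a : Fin n → ZMod b) (t : ℝ) : ℂ := ∏ j : Fin n, digitChar j (a j) t

/-- The integral over the unit cube of `g` against the tensor product of the `u k`. -/
def tensorIntegral (g : (Fin s → ℝ) → ℝ) (u : Fin s → ℝ → ℂ) : ℂ :=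
  ∫ x in openCube (Fin s), (g x : ℂ) * ∏ k, u k (x k)

/-- The half-open `b`-adic interval with digits `d`. -/
def digitInterval (d : Fin n → ZMod b) : Set ℝ :=
  Set.Ico (∑ j : Fin n, ((d j).val : ℝ) * ((b : ℝ) ^ ((j : ℕ) + 1))⁻¹)
    ((∑ j : Fin n, ((d j).val : ℝ) * ((b : ℝ) ^ ((j : ℕ) + 1))⁻¹) + ((b : ℝ) ^ n)⁻¹)

/-- The `b`-adic interval with digits `d` consists of the `t ∈ [0, 1)` with these digits. -/
lemma mem_digitInterval_iff [NeZero b] (d : Fin n → ZMod b) (t : ℝ) :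
    t ∈ digitInterval d ↔ t ∈ Set.Ico (0 : ℝ) 1 ∧
      ∀ j : Fin n, ((⌊(b : ℝ) ^ ((j : ℕ) + 1) * t⌋ : ℤ) : ZMod b) = d j := by
  have hb : (0 : ℝ) < b := by exact_mod_cast NeZero.pos b
  -- the left end point is an integer multiple of `b^(-n)`
  have hint : ∀ (n : ℕ) (d : Fin n → ZMod b), ∃ m : ℤ,
      (∑ j : Fin n, ((d j).val : ℝ) * ((b : ℝ) ^ ((j : ℕ) + 1))⁻¹) = m * ((b : ℝ) ^ n)⁻¹ ∧
      (⌊(b : ℝ) ^ n * t⌋ = m ↔ t ∈ Set.Ico (0 : ℝ) 1 ∧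
        ∀ j : Fin n, ((⌊(b : ℝ) ^ ((j : ℕ) + 1) * t⌋ : ℤ) : ZMod b) = d j) := by
    intro n
    induction n with
    | zero =>
      intro d
      refine ⟨0, by simp, ?_⟩
      simp [Int.floor_eq_zero_iff]
    | succ n ih =>
      intro d
      obtain ⟨m, hm, hiff⟩ := ih (fun j => d j.castSucc)
      refine ⟨b * m + (d (Fin.last n)).val, ?_, ?_⟩
      · rw [Fin.sum_univ_castSucc]
        simp only [Fin.val_castSucc, Fin.val_last]
        rw [hm]
        push_cast
        field_simp
        ring
      · rw [Fin.forall_iff_castSucc, and_comm (a := _ = d (Fin.last n)), ← and_assoc]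
        simp only [Fin.val_castSucc, Fin.val_last]
        rw [← hiff]
        have hdiv : ⌊(b : ℝ) ^ n * t⌋ = ⌊(b : ℝ) ^ (n + 1) * t⌋ / b := by
          rw [pow_succ', mul_assoc, Int.natCast_mul_floor_div_cancel (NeZero.ne b)]
        rw [hdiv]
        generalize ⌊(b : ℝ) ^ (n + 1) * t⌋ = q
        have hb' : (0 : ℤ) < b := by exact_mod_cast NeZero.pos b
        have hv : ((d (Fin.last n)).val : ℤ) < b := by exact_mod_cast ZMod.val_lt _
        have hv' : (((d (Fin.last n)).val : ℤ) : ZMod b) = d (Fin.last n) := by simp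
        have hmod : (q : ZMod b) = d (Fin.last n) ↔ q % b = (d (Fin.last n)).val := by
          conv_lhs => rhs; rw [← hv']
          rw [ZMod.intCast_eq_intCast_iff', Int.emod_eq_of_lt (by positivity) hv]
        rw [hmod]
        constructor
        · rintro rfl
          refine ⟨?_, ?_⟩
          · rw [add_comm, Int.add_mul_ediv_left _ _ hb'.ne', Int.ediv_eq_zero_of_lt
              (by positivity) hv, zero_add]
          · rw [add_comm, Int.add_mul_emod_self_left, Int.emod_eq_of_lt (by positivity) hv]
        · rintro ⟨rfl, h2⟩
          rw [← h2]
          exact (Int.mul_ediv_add_emod q b).symm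
  obtain ⟨m, hm, hiff⟩ := hint n d
  rw [← hiff, digitInterval, hm, Int.floor_eq_iff, Set.mem_Ico]
  have hbn : (0 : ℝ) < (b : ℝ) ^ n := by positivity
  rw [← div_eq_mul_inv, div_le_iff₀ hbn, inv_eq_one_div, ← add_div, lt_div_iff₀ hbn, mul_comm t]

lemma mem_digitBox_iff [NeZero b] (X : DigitMatrix b s n) (x : Fin s → ℝ) :
    x ∈ digitBox X ↔ x ∈ (Set.univ.pi fun _ => Set.Ico (0 : ℝ) 1) ∧
      ∀ i, ∀ j : Fin n, ((⌊(b : ℝ) ^ ((j : ℕ) + 1) * x i⌋ : ℤ) : ZMod b) = X i j := by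
  have : digitBox X = Set.univ.pi fun i => digitInterval (X i) := rfl
  rw [this]
  simp only [Set.mem_univ_pi, mem_digitInterval_iff, ← forall_and]

lemma iUnion_digitBox [NeZero b] :
    ⋃ X : DigitMatrix b s n, digitBox X = Set.univ.pi fun _ => Set.Ico (0 : ℝ) 1 := by
  ext x
  simp only [Set.mem_iUnion, mem_digitBox_iff]
  refine ⟨fun ⟨_, h⟩ => h.1, fun h =>
    ⟨fun i j => ((⌊(b : ℝ) ^ ((j : ℕ) + 1) * x i⌋ : ℤ) : ZMod b), h, fun _ _ => rfl⟩⟩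

lemma pairwise_disjoint_digitBox [NeZero b] :
    Pairwise (Function.onFun Disjoint fun X : DigitMatrix b s n => digitBox X) := by
  intro X Y hXY
  rw [Function.onFun, Set.disjoint_left]
  intro x hx hy
  rw [mem_digitBox_iff] at hx hy
  exact hXY (by ext i j; rw [← hx.2 i j, hy.2 i j])

lemma measurableSet_digitBox (X : DigitMatrix b s n) : MeasurableSet (digitBox X) :=
  MeasurableSet.univ_pi fun _ => measurableSet_Ico

lemma addChar_sum {R M ι : Type*} [AddCommMonoid R] [CommMonoid M] (χ : AddChar R M)
    (t : Finset ι) (f : ι → R) : χ (∑ i ∈ t, f i) = ∏ i ∈ t, χ (f i) := by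
  classical
  induction t using Finset.induction_on with
  | empty => simp
  | insert i t hi ih => rw [Finset.sum_insert hi, Finset.prod_insert hi, AddChar.map_add_eq_mul, ih]

lemma prod_walsh_of_mem [NeZero b] {A X : DigitMatrix b s n} {x : Fin s → ℝ}
    (hx : x ∈ digitBox X) : ∏ i, walsh (A i) (x i) = pairing A X := by
  rw [mem_digitBox_iff] at hx
  simp only [walsh, digitChar, pairing, hx.2]
  rw [addChar_sum]
  exact Finset.prod_congr rfl fun i _ => (addChar_sum _ _ _).symm

lemma volume_digitBox [NeZero b] (X : DigitMatrix b s n) :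
    volume.real (digitBox X) = (Fintype.card (DigitMatrix b s n) : ℝ)⁻¹ := by
  rw [measureReal_def, digitBox, volume_pi_pi]
  simp [Matrix, ZMod.card, ← pow_mul, ENNReal.toReal_ofReal]

lemma openCube_ae_eq (ι : Type*) [Fintype ι] :
    (openCube ι : Set (ι → ℝ)) =ᵐ[volume] Set.univ.pi fun _ => Set.Ico (0 : ℝ) 1 :=
  Measure.univ_pi_Ioo_ae_eq_Icc.trans Measure.univ_pi_Ico_ae_eq_Icc.symm

lemma norm_digitChar [NeZero b] (j : ℕ) (a : ZMod b) (t : ℝ) : ‖digitChar j a t‖ = 1 :=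
  AddChar.norm_apply _ _

lemma measurable_digitChar [NeZero b] (j : ℕ) (a : ZMod b) : Measurable (digitChar j a) := by
  have h : Measurable fun m : ℤ => (ZMod.stdAddChar (a * (m : ZMod b)) : ℂ) :=
    measurable_of_countable _
  exact h.comp (Int.measurable_floor.comp (measurable_const_mul _))

lemma norm_walsh [NeZero b] (a : Fin n → ZMod b) (t : ℝ) : ‖walsh a t‖ = 1 := by
  simp [walsh, norm_prod, norm_digitChar]

lemma measurable_walsh [NeZero b] (a : Fin n → ZMod b) : Measurable (walsh a) :=
  Finset.measurable_fun_prod _ fun _ _ => measurable_digitChar _ _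

/-- The discrete Fourier coefficients of `f_n` are Walsh coefficients of `f`. -/
lemma fourierCoeff_discretization [NeZero b] {f : (Fin s → ℝ) → ℝ}
    (hf : IntegrableOn f (openCube (Fin s))) (A : DigitMatrix b s n) :
    fourierCoeff (discretization f) A = tensorIntegral f fun i => walsh (A i) := by
  have hae := openCube_ae_eq (Fin s)
  have hint : IntegrableOn (fun x => (f x : ℂ) * ∏ k, walsh (A k) (x k))
      (Set.univ.pi fun _ => Set.Ico (0 : ℝ) 1) := by
    have h1 : IntegrableOn f (Set.univ.pi fun _ => Set.Ico (0 : ℝ) 1) :=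
      hf.congr_set_ae hae.symm
    refine (Integrable.ofReal h1).mul_bdd (c := 1) ?_ ?_
    · exact (Finset.measurable_fun_prod _ fun k _ =>
        (measurable_walsh (A k)).comp (measurable_pi_apply k)).aestronglyMeasurable
    · exact Filter.Eventually.of_forall fun x => by simp [norm_prod, norm_walsh]
  rw [tensorIntegral, setIntegral_congr_set hae, ← iUnion_digitBox (b := b) (n := n),
    integral_iUnion_fintype (fun X => measurableSet_digitBox X) pairwise_disjoint_digitBox
      (fun X => hint.mono_set ?_), fourierCoeff, Finset.mul_sum]
  · refine Finset.sum_congr rfl fun X _ => ?_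
    rw [setIntegral_congr_fun (g := fun x => (f x : ℂ) * pairing A X) (measurableSet_digitBox X)
      (fun x hx => by simp only [prod_walsh_of_mem hx]), integral_mul_const, integral_complex_ofReal,
      discretization, volume_digitBox]
    push_cast
    field_simp
  · rw [← iUnion_digitBox (b := b) (n := n)]
    exact Set.subset_iUnion _ X

end Walsh

/-! ### Iterated centered primitives of Walsh functions -/

/-- The mean of `u` over the unit interval. -/
def mean (u : ℝ → ℂ) : ℂ := ∫ t in (0 : ℝ)..1, u t

/-- The primitive of `u - mean u` that vanishes at `0`, and hence also at `1`. -/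
def centeredPrimitive (u : ℝ → ℂ) (x : ℝ) : ℂ := ∫ t in (0 : ℝ)..x, (u t - mean u)

lemma intervalIntegrable_of_bdd {u : ℝ → ℂ} (hu : Measurable u) {C : ℝ} (hC : ∀ x, ‖u x‖ ≤ C)
    (x y : ℝ) : IntervalIntegrable u volume x y :=
  (intervalIntegrable_const (c := C)).mono_fun hu.aestronglyMeasurable
    (Filter.Eventually.of_forall fun t => (hC t).trans (le_abs_self C))

section Periodic

variable {g w : ℝ → ℂ} {δ C : ℝ}

lemma periodic_primitive (hg : Measurable g) (hC : ∀ x, ‖g x‖ ≤ C)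
    (hper : Function.Periodic g δ) (h0 : ∫ t in (0 : ℝ)..δ, g t = 0) :
    Function.Periodic (fun x => ∫ t in (0 : ℝ)..x, g t) δ := by
  intro x
  have hi := intervalIntegrable_of_bdd hg hC
  have h1 : ∫ t in x..(x + δ), g t = 0 := by
    rw [hper.intervalIntegral_add_eq x 0, zero_add, h0]
  beta_reduce
  rw [← intervalIntegral.integral_add_adjacent_intervals (hi 0 x) (hi x (x + δ)), h1, add_zero]

lemma norm_primitive_le (hδ : 0 < δ) (hg : Measurable g) (hC : ∀ x, ‖g x‖ ≤ C)
    (hper : Function.Periodic g δ) (h0 : ∫ t in (0 : ℝ)..δ, g t = 0) (x : ℝ) :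
    ‖∫ t in (0 : ℝ)..x, g t‖ ≤ δ * C := by
  obtain ⟨y, hy, hxy⟩ := (periodic_primitive hg hC hper h0).exists_mem_Ico₀ hδ x
  rw [hxy]
  have hC0 : 0 ≤ C := (norm_nonneg _).trans (hC 0)
  refine (intervalIntegral.norm_integral_le_of_norm_le_const fun t _ => hC t).trans ?_
  rw [sub_zero, abs_of_nonneg hy.1, mul_comm]
  exact mul_le_mul_of_nonneg_right hy.2.le hC0

/-- A factor that is constant on the cells of length `δ` can be pulled out of the primitive of a
`δ`-periodic function of mean zero. -/
lemma primitive_mul_eq (hδ : 0 < δ) (hw : Measurable w) {D : ℝ} (hD : ∀ x, ‖w x‖ ≤ D)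
    (hcell : ∀ x y, ⌊x / δ⌋ = ⌊y / δ⌋ → w x = w y)
    (hg : Measurable g) (hC : ∀ x, ‖g x‖ ≤ C)
    (hper : Function.Periodic g δ) (h0 : ∫ t in (0 : ℝ)..δ, g t = 0) (x : ℝ) :
    ∫ t in (0 : ℝ)..x, w t * g t = w x * ∫ t in (0 : ℝ)..x, g t := by
  have hi := intervalIntegrable_of_bdd hg hC
  have hi2 : ∀ x y, IntervalIntegrable (fun t => w t * g t) volume x y :=
    intervalIntegrable_of_bdd (hw.mul hg) (C := D * C) fun x => by
    rw [norm_mul]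
    exact mul_le_mul (hD x) (hC x) (norm_nonneg _) ((norm_nonneg _).trans (hD x))
  -- inside one cell the factor is constant
  have hstep : ∀ (k : ℤ) (x : ℝ), k * δ ≤ x → x ≤ (k + 1) * δ →
      ∫ t in (k * δ)..x, w t * g t = w (k * δ) * ∫ t in (k * δ)..x, g t := by
    intro k x h1 h2
    rw [← intervalIntegral.integral_const_mul]
    apply intervalIntegral.integral_congr_ae
    have hne : ∀ᵐ t : ℝ, t ≠ x := Measure.ae_ne volume x
    filter_upwards [hne] with t htx ht
    rw [Set.uIoc_of_le h1] at ht
    rw [hcell t (k * δ)]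
    rw [mul_div_cancel_right₀ _ hδ.ne', Int.floor_intCast, Int.floor_eq_iff, le_div_iff₀ hδ,
      div_lt_iff₀ hδ]
    exact ⟨ht.1.le, (lt_of_le_of_ne ht.2 htx).trans_le h2⟩
  have hper0 : ∀ k : ℤ, ∫ t in (k * δ)..((k + 1) * δ), g t = 0 := by
    intro k
    rw [add_mul, one_mul, hper.intervalIntegral_add_eq (k * δ) 0, zero_add, h0]
  have hzero : ∀ k : ℤ, ∫ t in (0 : ℝ)..(k * δ), w t * g t = 0 := by
    have hs : ∀ k : ℤ, ∫ t in (0 : ℝ)..((k + 1) * δ), w t * g t =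
        ∫ t in (0 : ℝ)..(k * δ), w t * g t := by
      intro k
      rw [← intervalIntegral.integral_add_adjacent_intervals (hi2 0 (k * δ)) (hi2 _ ((k + 1) * δ))]
      have := hstep k ((k + 1) * δ) (by nlinarith) le_rfl
      rw [hper0, mul_zero] at this
      rw [this, add_zero]
    intro k
    induction k using Int.induction_on with
    | zero => simp
    | succ k ih => have := hs k; push_cast at this ih ⊢; rw [this, ih]
    | pred k ih =>
      have := hs (-k - 1); push_cast at this ih ⊢; rw [sub_add_cancel] at this
      rw [← this, ih]
  have hzero' : ∀ k : ℤ, ∫ t in (0 : ℝ)..(k * δ), g t = 0 := by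
    intro k
    have := (periodic_primitive hg hC hper h0).int_mul k 0
    simpa using this
  set k := ⌊x / δ⌋ with hk
  have hk1 : k * δ ≤ x := by rw [← le_div_iff₀ hδ]; exact Int.floor_le _
  have hk2 : x ≤ (k + 1) * δ := by rw [← div_le_iff₀ hδ]; exact (Int.lt_floor_add_one _).le
  have hwx : w x = w (k * δ) := by
    apply hcell
    rw [mul_div_cancel_right₀ _ hδ.ne', Int.floor_intCast]
  rw [← intervalIntegral.integral_add_adjacent_intervals (hi 0 (k * δ)) (hi _ x),
    ← intervalIntegral.integral_add_adjacent_intervals (hi2 0 (k * δ)) (hi2 _ x)]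
  rw [hzero, hzero', zero_add, zero_add, hstep k x hk1 hk2, hwx]

end Periodic

section DigitChar

variable {b : ℕ} [NeZero b]

lemma digitChar_zero (j : ℕ) (t : ℝ) : digitChar j (0 : ZMod b) t = 1 := by
  simp [digitChar]

lemma digitChar_add (j : ℕ) (a : ZMod b) (t : ℝ) :
    digitChar j a (t + ((b : ℝ) ^ (j + 1))⁻¹) = ZMod.stdAddChar a * digitChar j a t := by
  have hb : (b : ℝ) ≠ 0 := by exact_mod_cast NeZero.ne b
  rw [digitChar, mul_add, mul_inv_cancel₀ (pow_ne_zero _ hb), Int.floor_add_one, digitChar,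
    ← AddChar.map_add_eq_mul]
  congr 1
  push_cast
  ring

lemma periodic_digitChar (j : ℕ) (a : ZMod b) :
    Function.Periodic (digitChar j a) ((b : ℝ) ^ j)⁻¹ := by
  have hb : (b : ℝ) ≠ 0 := by exact_mod_cast NeZero.ne b
  intro t
  have : (b : ℝ) ^ (j + 1) * (t + ((b : ℝ) ^ j)⁻¹) = (b : ℝ) ^ (j + 1) * t + (b : ℕ) := by
    field_simp
    ring
  rw [digitChar, this, Int.floor_add_natCast, digitChar]
  push_cast
  simp

/-- `digitChar j a` is constant on the `b`-adic cells of length `b^(-J)`, for every `J > j`. -/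
lemma digitChar_eq_of_floor_eq {j J : ℕ} (hj : j < J) (a : ZMod b) {x y : ℝ}
    (h : ⌊x / ((b : ℝ) ^ J)⁻¹⌋ = ⌊y / ((b : ℝ) ^ J)⁻¹⌋) : digitChar j a x = digitChar j a y := by
  have hfl : ∀ x : ℝ, ⌊(b : ℝ) ^ (j + 1) * x⌋ = 
      ⌊x / ((b : ℝ) ^ J)⁻¹⌋ / ((b ^ (J - (j + 1)) : ℕ) : ℤ) := by
    intro x
    have : x / ((b : ℝ) ^ J)⁻¹ = ((b ^ (J - (j + 1)) : ℕ) : ℝ) * ((b : ℝ) ^ (j + 1) * x) := by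
      push_cast
      rw [← mul_assoc, ← pow_add, Nat.sub_add_cancel hj, div_inv_eq_mul, mul_comm]
    rw [this, Int.natCast_mul_floor_div_cancel (pow_ne_zero _ (NeZero.ne b))]
  rw [digitChar, digitChar, hfl, hfl, h]

lemma periodic_inv_pow_of_succ {H : ℝ → ℂ} {j : ℕ}
    (hH : Function.Periodic H ((b : ℝ) ^ (j + 1))⁻¹) : Function.Periodic H ((b : ℝ) ^ j)⁻¹ := by
  have hb : (b : ℝ) ≠ 0 := by exact_mod_cast NeZero.ne b
  have := hH.nat_mul b
  have h2 : (b : ℝ) * ((b : ℝ) ^ (j + 1))⁻¹ = ((b : ℝ) ^ j)⁻¹ := by field_simp; ring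
  rwa [h2] at this

/-- Over one period, a nontrivial digit character is orthogonal to every function whose period is
the length of one digit cell: the shift by one cell multiplies the integral by a root of unity
other than `1`. -/
lemma integral_digitChar_mul_eq_zero {j : ℕ} {a : ZMod b} (ha : a ≠ 0) {H : ℝ → ℂ}
    (hH : Function.Periodic H ((b : ℝ) ^ (j + 1))⁻¹) :
    ∫ t in (0 : ℝ)..((b : ℝ) ^ j)⁻¹, digitChar j a t * H t = 0 := by
  set δ := ((b : ℝ) ^ (j + 1))⁻¹
  set P := ((b : ℝ) ^ j)⁻¹
  have hper : Function.Periodic (fun t => digitChar j a t * H t) P :=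
    (periodic_digitChar j a).mul (periodic_inv_pow_of_succ hH)
  have h1 : ∫ t in (0 : ℝ)..P, digitChar j a (t + δ) * H (t + δ) =
      ∫ t in (0 : ℝ)..P, digitChar j a t * H t := by
    rw [intervalIntegral.integral_comp_add_right (fun t => digitChar j a t * H t), zero_add,
      add_comm P, hper.intervalIntegral_add_eq δ 0, zero_add]
  have h2 : ∫ t in (0 : ℝ)..P, digitChar j a (t + δ) * H (t + δ) =
      ZMod.stdAddChar a * ∫ t in (0 : ℝ)..P, digitChar j a t * H t := by
    rw [← intervalIntegral.integral_const_mul]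
    congr 1; ext t
    rw [hH t, digitChar_add, mul_assoc]
  have hne : ZMod.stdAddChar a ≠ 1 := by
    intro h
    apply ha
    apply ZMod.injective_stdAddChar
    rw [h, AddChar.map_zero_eq_one]
  have h3 : (ZMod.stdAddChar a - 1) * ∫ t in (0 : ℝ)..P, digitChar j a t * H t = 0 := by
    rw [sub_mul, one_mul, ← h2, h1, sub_self]
  exact (mul_eq_zero.mp h3).resolve_left (sub_ne_zero.mpr hne)

/-- In base two a nontrivial digit character is odd, up to the dyadic points. -/
lemma digitChar_neg_ae {b : ℕ} [NeZero b] (hb : b = 2) (j : ℕ) {a : ZMod b} (ha : a ≠ 0) :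
    ∀ᵐ t : ℝ, digitChar j a (-t) = -digitChar j a t := by
  subst hb
  have hcount : (Set.range fun m : ℤ => (m : ℝ) / 2 ^ (j + 1)).Countable := Set.countable_range _
  filter_upwards [hcount.ae_notMem volume] with t ht
  have hfl : ⌊((2 : ℕ) : ℝ) ^ (j + 1) * -t⌋ = -⌊((2 : ℕ) : ℝ) ^ (j + 1) * t⌋ - 1 := by
    rw [mul_neg, Int.floor_neg, Int.ceil_eq_floor_add_one_iff_notMem _ |>.mpr]
    · ring
    · rintro ⟨m, hm⟩
      apply ht
      refine ⟨m, ?_⟩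
      simp only [hm]
      push_cast
      field_simp
  have h1 : a = 1 := by
    revert ha; revert a; decide
  have hm1 : (ZMod.stdAddChar (1 : ZMod 2) : ℂ) = -1 := by
    have := ZMod.stdAddChar_coe (N := 2) 1
    simp only [Int.cast_one] at this
    rw [this]
    have h : 2 * (Real.pi : ℂ) * Complex.I * (1 : ℤ) / (2 : ℕ) = Real.pi * Complex.I := by
      push_cast; ring
    rw [← Complex.exp_pi_mul_I]
    congr 1
    push_cast; ring
  rw [digitChar, hfl, digitChar, h1]
  have h2 : ((1 : ZMod 2) * ((-⌊((2 : ℕ) : ℝ) ^ (j + 1) * t⌋ - 1 : ℤ) : ZMod 2)) =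
      1 * ((⌊((2 : ℕ) : ℝ) ^ (j + 1) * t⌋ : ℤ) : ZMod 2) + 1 := by
    push_cast
    rw [sub_eq_add_neg, ZMod.neg_eq_self_mod_two, ZMod.neg_eq_self_mod_two]
    ring
  rw [h2, AddChar.map_add_eq_mul, hm1]
  ring

end DigitChar

section IteratedPrimitive

variable {b n : ℕ} [NeZero b]

/-- The Walsh function of the first `J` digits of `a`. -/
def walshPrefix (a : ℕ → ZMod b) (J : ℕ) (t : ℝ) : ℂ :=
  ∏ j ∈ Finset.range J, digitChar j (a j) t

/-- The number of nonzero digits with index in `[J, n)`. -/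
def digitCount (a : ℕ → ZMod b) (n J : ℕ) : ℕ :=
  ∑ j ∈ Finset.Ico J n, if a j = 0 then 0 else 1

/-- The sum of the positions of the nonzero digits with index in `[J, n)`. -/
def digitWeight (a : ℕ → ZMod b) (n J : ℕ) : ℕ :=
  ∑ j ∈ Finset.Ico J n, if a j = 0 then 0 else j + 1

lemma norm_walshPrefix (a : ℕ → ZMod b) (J : ℕ) (t : ℝ) : ‖walshPrefix a J t‖ = 1 := by
  simp [walshPrefix, norm_prod, norm_digitChar]

lemma measurable_walshPrefix (a : ℕ → ZMod b) (J : ℕ) : Measurable (walshPrefix a J) :=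
  Finset.measurable_fun_prod _ fun _ _ => measurable_digitChar _ _

lemma walshPrefix_succ (a : ℕ → ZMod b) (J : ℕ) (t : ℝ) :
    walshPrefix a (J + 1) t = walshPrefix a J t * digitChar J (a J) t :=
  Finset.prod_range_succ _ _

lemma walshPrefix_eq_of_floor_eq (a : ℕ → ZMod b) (J : ℕ) (x y : ℝ)
    (h : ⌊x / ((b : ℝ) ^ J)⁻¹⌋ = ⌊y / ((b : ℝ) ^ J)⁻¹⌋) : walshPrefix a J x = walshPrefix a J y :=
  Finset.prod_congr rfl fun _ hj => digitChar_eq_of_floor_eq (Finset.mem_range.mp hj) _ h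

/-- One centered primitive removes the last nonzero digit from the Walsh factor. -/
lemma centeredPrimitive_walshPrefix_mul (a : ℕ → ZMod b) (J : ℕ) (ha : a J ≠ 0) {H : ℝ → ℂ}
    {C : ℝ} (hHc : Measurable H) (hHC : ∀ x, ‖H x‖ ≤ C)
    (hper : Function.Periodic H ((b : ℝ) ^ (J + 1))⁻¹) :
    mean (fun t => walshPrefix a (J + 1) t * H t) = 0 ∧
    centeredPrimitive (fun t => walshPrefix a (J + 1) t * H t) =
      fun x => walshPrefix a J x * ∫ t in (0 : ℝ)..x, digitChar J (a J) t * H t := by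
  have hb : (0 : ℝ) < b := by exact_mod_cast NeZero.pos b
  set g : ℝ → ℂ := fun t => digitChar J (a J) t * H t
  have hg : Measurable g := (measurable_digitChar _ _).mul hHc
  have hgC : ∀ x, ‖g x‖ ≤ C := fun x => by simp only [g, norm_mul, norm_digitChar, one_mul, hHC x]
  have hgper : Function.Periodic g ((b : ℝ) ^ J)⁻¹ :=
    (periodic_digitChar J _).mul (periodic_inv_pow_of_succ hper)
  have h0 := integral_digitChar_mul_eq_zero ha hper
  have hprim : ∀ x, ∫ t in (0 : ℝ)..x, walshPrefix a (J + 1) t * H t =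
      walshPrefix a J x * ∫ t in (0 : ℝ)..x, g t := by
    intro x
    rw [← primitive_mul_eq (by positivity) (measurable_walshPrefix a J)
      (fun t => (norm_walshPrefix a J t).le) (walshPrefix_eq_of_floor_eq a J) hg hgC hgper h0]
    congr 1; ext t
    rw [walshPrefix_succ, mul_assoc]
  have hmean : mean (fun t => walshPrefix a (J + 1) t * H t) = 0 := by
    rw [mean, hprim]
    have h1 := (periodic_primitive hg hgC hgper h0).nat_mul (b ^ J) 0
    rw [zero_add] at h1
    push_cast at h1
    rw [mul_inv_cancel₀ (by positivity)] at h1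
    rw [h1]
    simp
  refine ⟨hmean, ?_⟩
  ext x
  simp only [centeredPrimitive, hmean, sub_zero]
  exact hprim x

lemma integral_primitive_of_even {h : ℝ → ℝ} (hh : Continuous h) (heven : ∀ x, h (-x) = h x) {p : ℝ}
    (hper : Function.Periodic h p) :
    ∫ x in (0 : ℝ)..p, ∫ t in (0 : ℝ)..x, h t = p * (∫ t in (0 : ℝ)..p, h t) / 2 := by
  set K : ℝ → ℝ := fun x => ∫ t in (0 : ℝ)..x, h t
  have hK : Continuous K := intervalIntegral.continuous_primitive
    (fun a b => hh.intervalIntegrable a b) 0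
  have hsym : ∀ x, K (p - x) = K p - K x := by
    intro x
    have h1 : ∫ t in (0 : ℝ)..x, h (p - t) = ∫ t in (0 : ℝ)..x, h t := by
      congr 1; ext t
      rw [sub_eq_add_neg, add_comm, hper, heven]
    rw [intervalIntegral.integral_comp_sub_left h p, sub_zero] at h1
    simp only [K]
    rw [← h1, eq_sub_iff_add_eq]
    exact intervalIntegral.integral_add_adjacent_intervals (hh.intervalIntegrable _ _)
      (hh.intervalIntegrable _ _)
  have h2 : ∫ x in (0 : ℝ)..p, K (p - x) = ∫ x in (0 : ℝ)..p, K x := by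
    rw [intervalIntegral.integral_comp_sub_left K p, sub_self, sub_zero]
  simp_rw [hsym] at h2
  rw [intervalIntegral.integral_sub (by simp) (hK.intervalIntegrable _ _)] at h2
  simp only [intervalIntegral.integral_const, sub_zero, smul_eq_mul] at h2
  change ∫ x in (0 : ℝ)..p, K x = p * K p / 2
  linarith

/-- In base two, the passage from `H` to the primitive of `digitChar J a * H` keeps evenness and
multiplies the mean absolute value over a period by at most `2^(-(J + 2))`. -/
lemma primitive_digitChar_even (hb2 : b = 2) {J : ℕ} {a : ZMod b} (ha : a ≠ 0) {H : ℝ → ℂ}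
    (hHc : Continuous H) {C : ℝ} (hC : ∀ x, ‖H x‖ ≤ C)
    (hper : Function.Periodic H ((b : ℝ) ^ (J + 1))⁻¹)
    (heven : ∀ x, H (-x) = H x) :
    (∀ x, ∫ t in (0 : ℝ)..(-x), digitChar J a t * H t =
      ∫ t in (0 : ℝ)..x, digitChar J a t * H t) ∧
    ∫ x in (0 : ℝ)..((b : ℝ) ^ J)⁻¹, ‖∫ t in (0 : ℝ)..x, digitChar J a t * H t‖ ≤
      ((b : ℝ) ^ (J + 1))⁻¹ * ∫ t in (0 : ℝ)..((b : ℝ) ^ (J + 1))⁻¹, ‖H t‖ := by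
  set p := ((b : ℝ) ^ (J + 1))⁻¹ with hp
  have hp0 : 0 < p := by have := NeZero.pos b; positivity
  have hP : ((b : ℝ) ^ J)⁻¹ = p + p := by
    rw [hp, hb2]; push_cast; field_simp; ring
  set g : ℝ → ℂ := fun t => digitChar J a t * H t
  have hg : Measurable g := (measurable_digitChar _ _).mul hHc.measurable
  have hgn : ∀ x, ‖g x‖ = ‖H x‖ := fun x => by simp only [g, norm_mul, norm_digitChar, one_mul]
  have hgC : ∀ x, ‖g x‖ ≤ C := fun x => (hgn x).le.trans (hC x)
  have hgi := intervalIntegrable_of_bdd hg hgC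
  have hgper : Function.Periodic g ((b : ℝ) ^ J)⁻¹ :=
    (periodic_digitChar J _).mul (periodic_inv_pow_of_succ hper)
  have h0 := integral_digitChar_mul_eq_zero ha hper
  set G : ℝ → ℂ := fun x => ∫ t in (0 : ℝ)..x, g t with hG
  have hGc : Continuous G := intervalIntegral.continuous_primitive hgi 0
  have hGeven : ∀ x, G (-x) = G x := by
    intro x
    have h1 : ∫ t in (0 : ℝ)..x, g (-t) = -∫ t in (0 : ℝ)..x, g t := by
      rw [← intervalIntegral.integral_neg]
      apply intervalIntegral.integral_congr_ae
      filter_upwards [digitChar_neg_ae hb2 J ha] with t ht _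
      simp only [g, ht, heven, neg_mul]
    rw [intervalIntegral.integral_comp_neg, neg_zero, intervalIntegral.integral_symm, neg_inj] at h1
    exact h1
  refine ⟨hGeven, ?_⟩
  have hGper := periodic_primitive hg hgC hgper h0
  have hGn : Continuous fun x => ‖G x‖ := hGc.norm
  have hrefl : ∫ x in p..(p + p), ‖G x‖ = ∫ x in (0 : ℝ)..p, ‖G x‖ := by
    have h1 : ∫ x in (0 : ℝ)..p, ‖G (p + p - x)‖ = ∫ x in (0 : ℝ)..p, ‖G x‖ := by
      congr 1; ext x
      have : G (p + p - x) = G x := by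
        have := hGper (-x)
        rw [hP, ← sub_eq_neg_add] at this
        exact this.trans (hGeven x)
      rw [this]
    rw [intervalIntegral.integral_comp_sub_left (fun x => ‖G x‖) (p + p), sub_zero,
      add_sub_cancel_right] at h1
    exact h1
  rw [hP, ← intervalIntegral.integral_add_adjacent_intervals (hGn.intervalIntegrable 0 p)
    (hGn.intervalIntegrable p (p + p)), hrefl]
  have hle : ∫ x in (0 : ℝ)..p, ‖G x‖ ≤ ∫ x in (0 : ℝ)..p, ∫ t in (0 : ℝ)..x, ‖H t‖ := by
    apply intervalIntegral.integral_mono_on hp0.le (hGn.intervalIntegrable 0 p)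
    · exact (intervalIntegral.continuous_primitive
        (fun a b => hHc.norm.intervalIntegrable a b) 0).intervalIntegrable _ _
    · intro x hx
      refine (intervalIntegral.norm_integral_le_integral_norm hx.1).trans_eq ?_
      simp only [hgn]
  rw [integral_primitive_of_even hHc.norm (fun x => by rw [heven])
    (fun x => by simp only [hper x])] at hle
  linarith

/-- As many centered primitives as there are nonzero digits from index `J` on turn the Walsh
function into the product of its first `J` digit factors and a small periodic function. -/
lemma exists_iterate_centeredPrimitive (a : ℕ → ZMod b) {J : ℕ} (hJ : J ≤ n) :
    ∃ H : ℝ → ℂ, Continuous H ∧ Function.Periodic H ((b : ℝ) ^ J)⁻¹ ∧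
      (∀ x, ‖H x‖ ≤ (b : ℝ) ^ digitCount a n J * ((b : ℝ) ^ digitWeight a n J)⁻¹) ∧
      centeredPrimitive^[digitCount a n J] (walshPrefix a n) =
        (fun t => walshPrefix a J t * H t) ∧
      (∀ r < digitCount a n J, mean (centeredPrimitive^[r] (walshPrefix a n)) = 0) ∧
      (b = 2 → (∀ x, H (-x) = H x) ∧
        ∫ t in (0 : ℝ)..((b : ℝ) ^ J)⁻¹, ‖H t‖ ≤
          ((b : ℝ) ^ J)⁻¹ * ((b : ℝ) ^ (digitWeight a n J + digitCount a n J))⁻¹) := by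
  have hb : (0 : ℝ) < b := by exact_mod_cast NeZero.pos b
  induction hJ using Nat.decreasingInduction with
  | self =>
    refine ⟨fun _ => 1, continuous_const, fun _ => rfl, ?_, ?_, ?_, ?_⟩ <;>
      simp [digitCount, digitWeight]
  | of_succ J hJ ih =>
    obtain ⟨H, hHc, hper, hbd, hiter, hmean, htwo⟩ := ih
    by_cases ha : a J = 0
    · have hc : digitCount a n J = digitCount a n (J + 1) := by
        rw [digitCount, Finset.sum_eq_sum_Ico_succ_bot hJ, if_pos ha, zero_add]; rfl
      have hw : digitWeight a n J = digitWeight a n (J + 1) := by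
        rw [digitWeight, Finset.sum_eq_sum_Ico_succ_bot hJ, if_pos ha, zero_add]; rfl
      rw [hc, hw]
      refine ⟨H, hHc, periodic_inv_pow_of_succ hper, hbd, ?_, hmean, ?_⟩
      · rw [hiter]
        ext t
        rw [walshPrefix_succ, ha, digitChar_zero, mul_one]
      · intro hb2
        obtain ⟨h1, h2⟩ := htwo hb2
        refine ⟨h1, ?_⟩
        have hpn : Function.Periodic (fun t => ‖H t‖) ((b : ℝ) ^ (J + 1))⁻¹ :=
          fun x => by simp only [hper x]
        have hP : ((b : ℝ) ^ J)⁻¹ = ((b : ℝ) ^ (J + 1))⁻¹ + ((b : ℝ) ^ (J + 1))⁻¹ := by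
          rw [hb2]; push_cast; field_simp; ring
        rw [hP, ← intervalIntegral.integral_add_adjacent_intervals
          (hHc.norm.intervalIntegrable 0 ((b : ℝ) ^ (J + 1))⁻¹) (hHc.norm.intervalIntegrable _ _),
          hpn.intervalIntegral_add_eq _ 0, zero_add]
        linarith
    · have hc : digitCount a n J = digitCount a n (J + 1) + 1 := by
        rw [digitCount, Finset.sum_eq_sum_Ico_succ_bot hJ, if_neg ha, add_comm]; rfl
      have hw : digitWeight a n J = digitWeight a n (J + 1) + (J + 1) := by
        rw [digitWeight, Finset.sum_eq_sum_Ico_succ_bot hJ, if_neg ha, add_comm]; rfl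
      rw [hc, hw]
      obtain ⟨hm0, hprim⟩ := centeredPrimitive_walshPrefix_mul a J ha hHc.measurable hbd hper
      have hg : Measurable fun t => digitChar J (a J) t * H t :=
        (measurable_digitChar _ _).mul hHc.measurable
      have hgC : ∀ x, ‖digitChar J (a J) x * H x‖ ≤ (b : ℝ) ^ digitCount a n (J + 1) *
          ((b : ℝ) ^ digitWeight a n (J + 1))⁻¹ := fun x => by
        rw [norm_mul, norm_digitChar, one_mul]; exact hbd x
      have hgper : Function.Periodic (fun t => digitChar J (a J) t * H t) ((b : ℝ) ^ J)⁻¹ :=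
        (periodic_digitChar J _).mul (periodic_inv_pow_of_succ hper)
      have h0 := integral_digitChar_mul_eq_zero ha hper
      refine ⟨fun x => ∫ t in (0 : ℝ)..x, digitChar J (a J) t * H t,
        intervalIntegral.continuous_primitive (intervalIntegrable_of_bdd hg hgC) 0,
        periodic_primitive hg hgC hgper h0, ?_, ?_, ?_, ?_⟩
      · intro x
        refine (norm_primitive_le (by positivity) hg hgC hgper h0 x).trans_eq ?_
        simp only [pow_add, mul_inv]
        field_simp
      · rw [Function.iterate_succ_apply', hiter, hprim]
      · intro r hr
        rcases Nat.lt_succ_iff_lt_or_eq.mp hr with hr | rfl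
        · exact hmean r hr
        · rw [hiter, hm0]
      · intro hb2
        obtain ⟨h1, h2⟩ := htwo hb2
        obtain ⟨h3, h4⟩ := primitive_digitChar_even hb2 ha hHc hbd hper h1
        refine ⟨h3, h4.trans ?_⟩
        refine (mul_le_mul_of_nonneg_left h2 (by positivity)).trans_eq ?_
        simp only [pow_add, mul_inv]
        field_simp

/-- The Dick weight of one row of a digit matrix. -/
def rowWeight (a : Fin n → ZMod b) : ℕ := ∑ j : Fin n, if a j = 0 then 0 else (j : ℕ) + 1

/-- The Hamming weight of one row of a digit matrix. -/
def rowCount (a : Fin n → ZMod b) : ℕ := ∑ j : Fin n, if a j = 0 then 0 else 1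

omit [NeZero b] in
lemma rowCount_le (a : Fin n → ZMod b) : rowCount a ≤ n := by
  calc rowCount a ≤ ∑ _j : Fin n, 1 := Finset.sum_le_sum fun j _ => by split_ifs <;> simp
    _ = n := by simp

/-- The behaviour of the iterated centered primitives of a Walsh function with `v` nonzero
digits: the first `v` iterates have mean zero, and the next one has size `b^(v - μ)`. -/
lemma iterate_centeredPrimitive_walsh (a : Fin n → ZMod b) :
    (∀ r < rowCount a, mean (centeredPrimitive^[r] (walsh a)) = 0) ∧
    (∀ x, ‖centeredPrimitive^[rowCount a] (walsh a) x‖ ≤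
      (b : ℝ) ^ rowCount a * ((b : ℝ) ^ rowWeight a)⁻¹) ∧
    (b = 2 → ∫ t in (0 : ℝ)..1, ‖centeredPrimitive^[rowCount a] (walsh a) t‖ ≤
      ((b : ℝ) ^ (rowWeight a + rowCount a))⁻¹) := by
  set a' : ℕ → ZMod b := fun j => if h : j < n then a ⟨j, h⟩ else 0 with ha'
  have hw : walsh a = walshPrefix a' n := by
    ext t
    rw [walsh, walshPrefix, ← Fin.prod_univ_eq_prod_range]
    simp [ha']
  have hc : rowCount a = digitCount a' n 0 := by
    rw [digitCount, ← Finset.range_eq_Ico,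
      ← Fin.sum_univ_eq_sum_range (fun j => if a' j = 0 then 0 else 1)]
    simp [ha', rowCount]
  have hm : rowWeight a = digitWeight a' n 0 := by
    rw [digitWeight, ← Finset.range_eq_Ico,
      ← Fin.sum_univ_eq_sum_range (fun j => if a' j = 0 then 0 else j + 1)]
    simp [ha', rowWeight]
  obtain ⟨H, -, -, hbd, hiter, hmean, htwo⟩ := exists_iterate_centeredPrimitive a' (Nat.zero_le n)
  rw [hw, hc, hm, hiter]
  simp only [walshPrefix, Finset.range_zero, Finset.prod_empty, one_mul]
  refine ⟨hmean, hbd, fun hb2 => ?_⟩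
  simpa using (htwo hb2).2

lemma norm_mean_le {u : ℝ → ℂ} {M : ℝ} (hM : ∀ x ∈ Set.Icc (0 : ℝ) 1, ‖u x‖ ≤ M) :
    ‖mean u‖ ≤ M := by
  have := intervalIntegral.norm_integral_le_of_norm_le_const (a := (0 : ℝ)) (b := 1) (f := u)
    (C := M) fun x hx => hM x (by rw [Set.uIoc_of_le zero_le_one] at hx; exact ⟨hx.1.le, hx.2⟩)
  simpa [mean] using this

lemma norm_centeredPrimitive_le {u : ℝ → ℂ} {M : ℝ} (hM : ∀ x ∈ Set.Icc (0 : ℝ) 1, ‖u x‖ ≤ M) :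
    ∀ x ∈ Set.Icc (0 : ℝ) 1, ‖centeredPrimitive u x‖ ≤ 2 * M := by
  intro x hx
  have hM0 : 0 ≤ M := (norm_nonneg _).trans (hM x hx)
  have := intervalIntegral.norm_integral_le_of_norm_le_const (a := (0 : ℝ)) (b := x)
    (f := fun t => u t - mean u) (C := 2 * M) fun t ht => by
      rw [Set.uIoc_of_le hx.1] at ht
      have h1 := hM t ⟨ht.1.le, ht.2.trans hx.2⟩
      have h2 := norm_mean_le hM
      exact (norm_sub_le _ _).trans (by linarith)
  refine this.trans ?_
  rw [sub_zero, abs_of_nonneg hx.1]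
  nlinarith [hx.2]

lemma norm_iterate_centeredPrimitive_walsh_le (hb : 1 ≤ b) (a : Fin n → ZMod b) {r : ℕ}
    (h1 : rowCount a ≤ r) (h2 : r ≤ n) {x : ℝ} (hx : x ∈ Set.Icc (0 : ℝ) 1) :
    ‖centeredPrimitive^[r] (walsh a) x‖ ≤ (2 * b : ℝ) ^ n * ((b : ℝ) ^ rowWeight a)⁻¹ := by
  have hb' : (1 : ℝ) ≤ b := by exact_mod_cast hb
  have key : ∀ k, ∀ x ∈ Set.Icc (0 : ℝ) 1, ‖centeredPrimitive^[rowCount a + k] (walsh a) x‖ ≤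
      2 ^ k * ((b : ℝ) ^ rowCount a * ((b : ℝ) ^ rowWeight a)⁻¹) := by
    intro k
    induction k with
    | zero => intro x _; simpa using (iterate_centeredPrimitive_walsh a).2.1 x
    | succ k ih =>
      intro x hx
      rw [← add_assoc, Function.iterate_succ_apply', pow_succ', mul_assoc]
      exact norm_centeredPrimitive_le ih x hx
  obtain ⟨k, rfl⟩ := Nat.exists_eq_add_of_le h1
  refine (key k x hx).trans ?_
  rw [mul_pow, ← mul_assoc]
  gcongr
  · norm_num
  · omega
  · exact rowCount_le a

lemma norm_mean_iterate_centeredPrimitive_walsh_le (hb : 1 ≤ b) (a : Fin n → ZMod b) {r : ℕ}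
    (h2 : r ≤ n) :
    ‖mean (centeredPrimitive^[r] (walsh a))‖ ≤ (2 * b : ℝ) ^ n * ((b : ℝ) ^ rowWeight a)⁻¹ := by
  rcases lt_or_ge r (rowCount a) with h | h
  · rw [(iterate_centeredPrimitive_walsh a).1 r h, norm_zero]
    positivity
  · exact norm_mean_le fun x hx => norm_iterate_centeredPrimitive_walsh_le hb a h h2 hx

end IteratedPrimitive

/-! ### Square integrable tensor products and density of test functions -/

section L2

/-- Lebesgue measure on the open unit interval. -/
abbrev unitMeasure : Measure ℝ := volume.restrict (Set.Ioo (0 : ℝ) 1)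

instance : IsProbabilityMeasure unitMeasure := ⟨by simp⟩

lemma restrict_openCube (ι : Type*) [Fintype ι] :
    (volume : Measure (ι → ℝ)).restrict (openCube ι) = Measure.pi fun _ => unitMeasure := by
  rw [openCube, volume_pi, Measure.restrict_pi_pi]

lemma lpNorm_two_sq {α : Type*} [MeasurableSpace α] {μ : Measure α} {f : α → ℂ}
    (hf : AEStronglyMeasurable f μ) : lpNorm f 2 μ = Real.sqrt (∫ x, ‖f x‖ ^ 2 ∂μ) := by
  rw [lpNorm_eq_integral_norm_rpow_toReal (by norm_num) (by norm_num) hf, Real.sqrt_eq_rpow]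
  norm_num

lemma integral_norm_mul_norm_le {α : Type*} [MeasurableSpace α] {μ : Measure α} {f g : α → ℂ}
    (hf : MemLp f 2 μ) (hg : MemLp g 2 μ) :
    ∫ x, ‖f x‖ * ‖g x‖ ∂μ ≤ lpNorm f 2 μ * lpNorm g 2 μ := by
  have h := integral_mul_norm_le_Lp_mul_Lq (μ := μ) (p := 2) (q := 2) (f := f) (g := g)
    ⟨by norm_num, by norm_num, by norm_num⟩ (by simpa using hf) (by simpa using hg)
  rw [lpNorm_two_sq hf.1, lpNorm_two_sq hg.1, Real.sqrt_eq_rpow, Real.sqrt_eq_rpow]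
  simpa using h

lemma lpNorm_le_of_bound {f : ℝ → ℂ} {C : ℝ} (hC : ∀ x ∈ Set.Ioo (0 : ℝ) 1, ‖f x‖ ≤ C) :
    lpNorm f 2 unitMeasure ≤ C := by
  have hC0 : 0 ≤ C := (norm_nonneg _).trans (hC (1 / 2) (by norm_num))
  by_cases hf : AEStronglyMeasurable f unitMeasure
  · rw [← toReal_eLpNorm hf]
    have := eLpNorm_le_of_ae_bound (p := 2) (μ := unitMeasure) (f := f) (C := C)
      ((ae_restrict_mem measurableSet_Ioo).mono fun x hx => hC x hx)
    apply ENNReal.toReal_le_of_le_ofReal hC0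
    simpa using this
  · rw [lpNorm_of_not_aestronglyMeasurable hf]; exact hC0

lemma memLp_of_bound {f : ℝ → ℂ} (hf : AEStronglyMeasurable f unitMeasure) {C : ℝ}
    (hC : ∀ x ∈ Set.Ioo (0 : ℝ) 1, ‖f x‖ ≤ C) : MemLp f 2 unitMeasure :=
  MemLp.of_bound hf C ((ae_restrict_mem measurableSet_Ioo).mono fun x hx => hC x hx)

lemma mean_eq_integral (u : ℝ → ℂ) : mean u = ∫ t, u t ∂unitMeasure := by
  rw [mean, intervalIntegral.integral_of_le zero_le_one, integral_Ioc_eq_integral_Ioo]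

lemma integral_norm_le_lpNorm {u : ℝ → ℂ} (hu : MemLp u 2 unitMeasure) :
    ∫ t, ‖u t‖ ∂unitMeasure ≤ lpNorm u 2 unitMeasure := by
  have h1 : MemLp (fun _ : ℝ => (1 : ℂ)) 2 unitMeasure := memLp_const _
  have h := integral_norm_mul_norm_le hu h1
  have h2 : lpNorm (fun _ : ℝ => (1 : ℂ)) 2 unitMeasure ≤ 1 :=
    lpNorm_le_of_bound fun _ _ => by simp
  simp only [norm_one, mul_one] at h
  exact h.trans (mul_le_of_le_one_right lpNorm_nonneg h2)

lemma norm_mean_le_lpNorm {u : ℝ → ℂ} (hu : MemLp u 2 unitMeasure) :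
    ‖mean u‖ ≤ lpNorm u 2 unitMeasure := by
  rw [mean_eq_integral]
  exact (norm_integral_le_integral_norm _).trans (integral_norm_le_lpNorm hu)

lemma MemLp.intervalIntegrable_unit {u : ℝ → ℂ} (hu : MemLp u 2 unitMeasure) :
    IntervalIntegrable u volume 0 1 := by
  rw [intervalIntegrable_iff_integrableOn_Ioo_of_le zero_le_one]
  exact hu.integrable (by norm_num)

/-- A linear map on functions that preserves square integrability on the unit interval and is
bounded in the `L²` norm. -/
structure IsL2Operator (S : (ℝ → ℂ) → ℝ → ℂ) : Prop where
  memLp : ∀ u, MemLp u 2 unitMeasure → MemLp (S u) 2 unitMeasure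
  add : ∀ u v, MemLp u 2 unitMeasure → MemLp v 2 unitMeasure →
    ∀ x ∈ Set.Ioo (0 : ℝ) 1, S (u + v) x = S u x + S v x
  smul : ∀ (c : ℂ) u, MemLp u 2 unitMeasure → ∀ x ∈ Set.Ioo (0 : ℝ) 1, S (c • u) x = c * S u x
  bound : ∃ K : ℝ, ∀ u, MemLp u 2 unitMeasure →
    lpNorm (S u) 2 unitMeasure ≤ K * lpNorm u 2 unitMeasure

/-- A linear functional on functions that is bounded in the `L²` norm of the unit interval. -/
structure IsL2Functional (L : (ℝ → ℂ) → ℂ) : Prop where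
  add : ∀ u v, MemLp u 2 unitMeasure → MemLp v 2 unitMeasure → L (u + v) = L u + L v
  smul : ∀ (c : ℂ) u, MemLp u 2 unitMeasure → L (c • u) = c * L u
  bound : ∃ K : ℝ, ∀ u, MemLp u 2 unitMeasure → ‖L u‖ ≤ K * lpNorm u 2 unitMeasure

lemma IsL2Functional.add' {L L' : (ℝ → ℂ) → ℂ} (h : IsL2Functional L) (h' : IsL2Functional L') :
    IsL2Functional fun u => L u + L' u where
  add u v hu hv := by rw [h.add u v hu hv, h'.add u v hu hv]; ring
  smul c u hu := by rw [h.smul c u hu, h'.smul c u hu]; ring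
  bound := by
    obtain ⟨K, hK⟩ := h.bound
    obtain ⟨K', hK'⟩ := h'.bound
    refine ⟨K + K', fun u hu => (norm_add_le _ _).trans ?_⟩
    rw [add_mul]
    exact add_le_add (hK u hu) (hK' u hu)

lemma IsL2Functional.neg {L : (ℝ → ℂ) → ℂ} (h : IsL2Functional L) :
    IsL2Functional fun u => -L u where
  add u v hu hv := by rw [h.add u v hu hv]; ring
  smul c u hu := by rw [h.smul c u hu]; ring
  bound := by simpa using h.bound

lemma IsL2Functional.comp {L : (ℝ → ℂ) → ℂ} (h : IsL2Functional L)
    (hcongr : ∀ u v, Set.EqOn u v (Set.Ioo 0 1) → L u = L v)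
    {S : (ℝ → ℂ) → ℝ → ℂ} (hS : IsL2Operator S) : IsL2Functional fun u => L (S u) where
  add u v hu hv := by
    rw [← h.add _ _ (hS.memLp u hu) (hS.memLp v hv)]
    exact hcongr _ _ (hS.add u v hu hv)
  smul c u hu := by
    rw [← h.smul _ _ (hS.memLp u hu)]
    exact hcongr _ _ (hS.smul c u hu)
  bound := by
    obtain ⟨K, hK⟩ := h.bound
    obtain ⟨K', hK'⟩ := hS.bound
    refine ⟨|K| * K', fun u hu => (hK _ (hS.memLp u hu)).trans ?_⟩
    rw [mul_assoc]
    exact mul_le_mul (le_abs_self K) (hK' u hu) lpNorm_nonneg (abs_nonneg K)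

/-- Subtracting a fixed multiple of the mean is a bounded operator. -/
lemma isL2Operator_sub_mean {η : ℝ → ℂ} (hη : MemLp η 2 unitMeasure) :
    IsL2Operator fun u => u - mean u • η where
  memLp u hu := hu.sub (hη.const_smul _)
  add u v hu hv x _ := by
    have : mean (u + v) = mean u + mean v :=
      intervalIntegral.integral_add (MemLp.intervalIntegrable_unit hu)
        (MemLp.intervalIntegrable_unit hv)
    simp [this]; ring
  smul c u hu x _ := by
    have : mean (c • u) = c * mean u := intervalIntegral.integral_const_mul c u
    simp [this]; ring
  bound := by
    refine ⟨1 + lpNorm η 2 unitMeasure, fun u hu => ?_⟩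
    refine (lpNorm_sub_le hu (by norm_num)).trans ?_
    rw [lpNorm_const_smul, add_mul, one_mul, mul_comm (lpNorm η 2 unitMeasure)]
    exact add_le_add le_rfl (mul_le_mul_of_nonneg_right (norm_mean_le_lpNorm hu) lpNorm_nonneg)

lemma norm_primitive_le_lpNorm {u : ℝ → ℂ} (hu : MemLp u 2 unitMeasure) {x : ℝ}
    (hx : x ∈ Set.Ioo (0 : ℝ) 1) : ‖∫ t in (0 : ℝ)..x, u t‖ ≤ lpNorm u 2 unitMeasure := by
  refine (intervalIntegral.norm_integral_le_integral_norm hx.1.le).trans ?_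
  refine le_trans ?_ (integral_norm_le_lpNorm hu)
  rw [intervalIntegral.integral_of_le hx.1.le]
  exact setIntegral_mono_set (hu.integrable (by norm_num)).norm
    (Filter.Eventually.of_forall fun _ => norm_nonneg _)
    (Set.Ioc_subset_Ioo_right hx.2).eventuallyLE

lemma MemLp.intervalIntegrable_of_mem {u : ℝ → ℂ} (hu : MemLp u 2 unitMeasure) {x : ℝ}
    (hx : x ∈ Set.Icc (0 : ℝ) 1) : IntervalIntegrable u volume 0 x :=
  (MemLp.intervalIntegrable_unit hu).mono_set (by
    rw [Set.uIcc_of_le hx.1, Set.uIcc_of_le zero_le_one]; exact Set.Icc_subset_Icc_right hx.2)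

lemma memLp_primitive {u : ℝ → ℂ} (hu : MemLp u 2 unitMeasure) :
    MemLp (fun x => ∫ t in (0 : ℝ)..x, u t) 2 unitMeasure := by
  refine memLp_of_bound ?_ fun x hx => norm_primitive_le_lpNorm hu hx
  have h1 : IntegrableOn u (Set.uIcc 0 1) := by
    rw [Set.uIcc_of_le zero_le_one]
    exact (intervalIntegrable_iff_integrableOn_Icc_of_le zero_le_one).mp
      (MemLp.intervalIntegrable_unit hu)
  have := intervalIntegral.continuousOn_primitive_interval h1
  rw [Set.uIcc_of_le zero_le_one] at this
  exact (this.mono Set.Ioo_subset_Icc_self).aestronglyMeasurable measurableSet_Ioo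

lemma isL2Operator_primitive : IsL2Operator fun u x => ∫ t in (0 : ℝ)..x, u t where
  memLp _ hu := memLp_primitive hu
  add u v hu hv x hx := intervalIntegral.integral_add
    (MemLp.intervalIntegrable_of_mem hu ⟨hx.1.le, hx.2.le⟩)
    (MemLp.intervalIntegrable_of_mem hv ⟨hx.1.le, hx.2.le⟩)
  smul c u _ x _ := intervalIntegral.integral_const_mul c u
  bound := ⟨1, fun u hu => by
    rw [one_mul]
    exact lpNorm_le_of_bound fun x hx => norm_primitive_le_lpNorm hu hx⟩

/-- `φ` is a test function on the open unit interval. -/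
def IsTest (φ : ℝ → ℝ) : Prop :=
  ContDiff ℝ ∞ φ ∧ HasCompactSupport φ ∧ tsupport φ ⊆ Set.Ioo 0 1

lemma IsTest.memLp {φ : ℝ → ℝ} (hφ : IsTest φ) :
    MemLp (fun t => (φ t : ℂ)) 2 unitMeasure :=
  ((hφ.1.continuous.memLp_of_hasCompactSupport hφ.2.1).ofReal).restrict _

end L2

section Density

lemma exists_cutoff {δ : ENNReal} (hδ : 0 < δ) : ∃ χ : ℝ → ℝ, IsTest χ ∧ (∀ x, 0 ≤ χ x) ∧
    (∀ x, χ x ≤ 1) ∧ unitMeasure {x | χ x ≠ 1} ≤ δ := by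
  obtain ⟨ε, hε0, hεδ, hε1⟩ : ∃ ε : ℝ, 0 < ε ∧ ENNReal.ofReal (2 * ε) ≤ δ ∧ ε < 1 / 2 := by
    rcases eq_or_ne δ ⊤ with rfl | hδt
    · exact ⟨1 / 4, by norm_num, le_top, by norm_num⟩
    · have h0 : 0 < δ.toReal := ENNReal.toReal_pos hδ.ne' hδt
      refine ⟨min (δ.toReal / 2) (1 / 4), by positivity, ?_, ?_⟩
      · apply ENNReal.ofReal_le_of_le_toReal
        have := min_le_left (δ.toReal / 2) (1 / 4)
        linarith
      · have := min_le_right (δ.toReal / 2) (1 / 4)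
        linarith
  let f : ContDiffBump (1 / 2 : ℝ) := ⟨1 / 2 - ε, 1 / 2 - ε / 2, by linarith, by linarith⟩
  refine ⟨f, ⟨f.contDiff, f.hasCompactSupport, ?_⟩, fun x => f.nonneg, fun x => f.le_one, ?_⟩
  · rw [f.tsupport_eq, Real.closedBall_eq_Icc]
    intro x hx
    change x ∈ Set.Icc (1 / 2 - (1 / 2 - ε / 2)) (1 / 2 + (1 / 2 - ε / 2)) at hx
    constructor <;> linarith [hx.1, hx.2]
  · have hsub : {x | f x ≠ 1} ∩ Set.Ioo 0 1 ⊆ Set.Ioo 0 ε ∪ Set.Ioo (1 - ε) 1 := by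
      rintro x ⟨hx, hx0, hx1⟩
      by_contra hcon
      simp only [Set.mem_union, Set.mem_Ioo, not_or, not_and, not_lt] at hcon
      apply hx
      apply f.one_of_mem_closedBall
      rw [Real.closedBall_eq_Icc]
      change x ∈ Set.Icc (1 / 2 - (1 / 2 - ε)) (1 / 2 + (1 / 2 - ε))
      have h1 := hcon.1 hx0
      have h2 : x ≤ 1 - ε := by
        by_contra h
        exact absurd (hcon.2 (not_le.mp h)) (not_le.mpr hx1)
      constructor <;> linarith
    have hm : MeasurableSet {x | f x ≠ 1} :=
      (f.continuous.measurable (measurableSet_singleton 1)).compl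
    rw [Measure.restrict_apply hm]
    refine (measure_mono hsub).trans ((measure_union_le _ _).trans ?_)
    rw [Real.volume_Ioo, Real.volume_Ioo, ← ENNReal.ofReal_add (by linarith) (by linarith)]
    refine le_trans (le_of_eq ?_) hεδ
    congr 1; ring

lemma IsTest.mul_contDiff {χ : ℝ → ℝ} (hχ : IsTest χ) {g : ℝ → ℝ} (hg : ContDiff ℝ ∞ g) :
    IsTest fun x => χ x * g x :=
  ⟨hχ.1.mul hg, hχ.2.1.mul_right, (closure_mono (Function.support_mul_subset_left _ _)).trans hχ.2.2⟩

/-- Test functions are dense in `L²` of the unit interval. -/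
lemma exists_test_lpNorm_sub_le {u : ℝ → ℂ} (hu : MemLp u 2 unitMeasure) {ε : ℝ} (hε : 0 < ε) :
    ∃ φ ψ : ℝ → ℝ, IsTest φ ∧ IsTest ψ ∧
      lpNorm (u - ((fun t => (φ t : ℂ)) + Complex.I • fun t => (ψ t : ℂ))) 2 unitMeasure ≤ ε := by
  obtain ⟨g, hg1, hg2, hg3⟩ := hu.exist_eLpNorm_sub_le (by norm_num) (by norm_num) (half_pos hε)
  have hgm : MemLp g 2 unitMeasure :=
    (hg2.continuous.memLp_of_hasCompactSupport hg1 (μ := volume)).restrict _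
  obtain ⟨M, hM⟩ := hg2.continuous.bounded_above_of_compact_support hg1
  have hM0 : 0 ≤ M := (norm_nonneg _).trans (hM 0)
  obtain ⟨η, hη0, hη⟩ := exists_eLpNorm_indicator_le (p := 2) (μ := unitMeasure) (by norm_num) M
    (ε := ENNReal.ofReal (ε / 2)) (by simpa using hε)
  obtain ⟨χ, hχ, hχ0, hχ1, hχm⟩ := exists_cutoff (δ := (η : ENNReal)) (by exact_mod_cast hη0)
  refine ⟨fun x => χ x * (g x).re, fun x => χ x * (g x).im,
    hχ.mul_contDiff (Complex.reCLM.contDiff.comp hg2),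
    hχ.mul_contDiff (Complex.imCLM.contDiff.comp hg2), ?_⟩
  set h : ℝ → ℂ := (fun t => ((χ t * (g t).re : ℝ) : ℂ)) +
    Complex.I • fun t => ((χ t * (g t).im : ℝ) : ℂ) with hh
  have hhx : ∀ x, h x = χ x * g x := by
    intro x
    simp only [hh, Pi.add_apply, Pi.smul_apply, smul_eq_mul]
    conv_rhs => rw [← Complex.re_add_im (g x)]
    push_cast; ring
  have hhm : MemLp h 2 unitMeasure :=
    (hχ.mul_contDiff (Complex.reCLM.contDiff.comp hg2)).memLp.add
      ((hχ.mul_contDiff (Complex.imCLM.contDiff.comp hg2)).memLp.const_smul _)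
  have h1 : lpNorm (u - g) 2 unitMeasure ≤ ε / 2 := by
    rw [← toReal_eLpNorm (hu.sub hgm).1]
    exact ENNReal.toReal_le_of_le_ofReal (by linarith) hg3
  have h2 : lpNorm (g - h) 2 unitMeasure ≤ ε / 2 := by
    rw [← toReal_eLpNorm (hgm.sub hhm).1]
    apply ENNReal.toReal_le_of_le_ofReal (by linarith)
    refine le_trans (eLpNorm_mono fun x => ?_) (hη {x | χ x ≠ 1} hχm)
    by_cases hx : χ x = 1
    · simp [hhx, hx]
    · rw [Set.indicator_of_mem (show x ∈ {x | χ x ≠ 1} from hx), Pi.sub_apply, hhx, Real.norm_eq_abs,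
        abs_of_nonneg hM0, ← one_sub_mul, norm_mul]
      refine (mul_le_of_le_one_left (norm_nonneg _) ?_).trans (hM x)
      rw [← Complex.ofReal_one, ← Complex.ofReal_sub, Complex.norm_real, Real.norm_eq_abs, abs_le]
      constructor <;> linarith [hχ0 x, hχ1 x]
  have h3 : u - h = (u - g) + (g - h) := by abel
  rw [h3]
  exact (lpNorm_add_le (hu.sub hgm) (by norm_num)).trans (by linarith)

lemma IsL2Functional.eq_zero {L : (ℝ → ℂ) → ℂ} (hL : IsL2Functional L)
    (h0 : ∀ φ, IsTest φ → L (fun t => (φ t : ℂ)) = 0) {u : ℝ → ℂ} (hu : MemLp u 2 unitMeasure) :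
    L u = 0 := by
  obtain ⟨K, hK⟩ := hL.bound
  by_contra hne
  have hpos : 0 < ‖L u‖ := norm_pos_iff.mpr hne
  obtain ⟨φ, ψ, hφ, hψ, hle⟩ := exists_test_lpNorm_sub_le hu
    (ε := ‖L u‖ / (2 * (|K| + 1))) (by positivity)
  set v : ℝ → ℂ := (fun t => (φ t : ℂ)) + Complex.I • fun t => (ψ t : ℂ)
  have hv : MemLp v 2 unitMeasure := hφ.memLp.add (hψ.memLp.const_smul _)
  have hLv : L v = 0 := by
    rw [hL.add _ _ hφ.memLp (hψ.memLp.const_smul _), hL.smul _ _ hψ.memLp, h0 _ hφ, h0 _ hψ]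
    simp
  have h1 : L u = L (u - v) := by
    have := hL.add _ _ (hu.sub hv) hv
    rwa [sub_add_cancel, hLv, add_zero] at this
  have h2 : ‖L u‖ ≤ |K| * (‖L u‖ / (2 * (|K| + 1))) := by
    conv_lhs => rw [h1]
    refine (hK _ (hu.sub hv)).trans ?_
    exact mul_le_mul (le_abs_self K) hle lpNorm_nonneg (abs_nonneg K)
  have h3 : |K| * (‖L u‖ / (2 * (|K| + 1))) < ‖L u‖ := by
    rw [mul_div_assoc', div_lt_iff₀ (by positivity)]
    nlinarith [abs_nonneg K]
  linarith

/-- A functional that is linear and `L²`-bounded in every coordinate vanishes if it vanishes on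
tuples of test functions. -/
lemma eq_zero_of_separately {s : ℕ} {D : (Fin s → ℝ → ℂ) → ℂ}
    (hD : ∀ u, (∀ k, MemLp (u k) 2 unitMeasure) → ∀ k,
      IsL2Functional fun w => D (Function.update u k w))
    (h0 : ∀ φ : Fin s → ℝ → ℝ, (∀ k, IsTest (φ k)) → D (fun k t => (φ k t : ℂ)) = 0)
    {u : Fin s → ℝ → ℂ} (hu : ∀ k, MemLp (u k) 2 unitMeasure) : D u = 0 := by
  have key : ∀ F : Finset (Fin s), ∀ u : Fin s → ℝ → ℂ, (∀ k ∈ F, MemLp (u k) 2 unitMeasure) →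
      (∀ k ∉ F, ∃ φ, IsTest φ ∧ u k = fun t => (φ t : ℂ)) → D u = 0 := by
    intro F
    induction F using Finset.induction_on with
    | empty =>
      intro u _ h
      choose φ hφ hu using fun k => h k (Finset.notMem_empty k)
      rw [funext hu]
      exact h0 φ hφ
    | insert k F hk ih =>
      intro u hm ht
      have hu : ∀ k, MemLp (u k) 2 unitMeasure := by
        intro j
        by_cases hj : j ∈ insert k F
        · exact hm j hj
        · obtain ⟨φ, hφ, h⟩ := ht j hj
          rw [h]; exact hφ.memLp
      have := (hD u hu k).eq_zero (fun φ hφ => ?_) (hu k)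
      · rwa [Function.update_eq_self] at this
      · apply ih
        · intro j hj
          rw [Function.update_of_ne (ne_of_mem_of_not_mem hj hk)]
          exact hu j
        · intro j hj
          by_cases hjk : j = k
          · subst hjk; exact ⟨φ, hφ, by simp⟩
          · rw [Function.update_of_ne hjk]
            exact ht j (by simp [hj, hjk])
  exact key Finset.univ u (fun k _ => hu k) (fun k hk => absurd (Finset.mem_univ k) hk)

end Density

section TensorIntegral

variable {s : ℕ} {g g' : (Fin s → ℝ) → ℝ}

lemma memLp_tensor {u : Fin s → ℝ → ℂ} (hu : ∀ k, MemLp (u k) 2 unitMeasure) :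
    MemLp (fun x : Fin s → ℝ => ∏ k, u k (x k)) 2 (Measure.pi fun _ => unitMeasure) := by
  have h1 : Integrable (fun x : Fin s → ℝ => ∏ k, u k (x k)) (Measure.pi fun _ => unitMeasure) :=
    Integrable.fintype_prod fun k => (hu k).integrable (by norm_num)
  rw [memLp_two_iff_integrable_sq_norm h1.1]
  have h2 : Integrable (fun x : Fin s → ℝ => ∏ k, ‖u k (x k)‖ ^ 2)
      (Measure.pi fun _ => unitMeasure) :=
    Integrable.fintype_prod (f := fun k t => ‖u k t‖ ^ 2) fun k =>
      (memLp_two_iff_integrable_sq_norm (hu k).1).mp (hu k)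
  simpa only [norm_prod, Finset.prod_pow] using h2

lemma lpNorm_tensor {u : Fin s → ℝ → ℂ} (hu : ∀ k, MemLp (u k) 2 unitMeasure) :
    lpNorm (fun x : Fin s → ℝ => ∏ k, u k (x k)) 2 (Measure.pi fun _ => unitMeasure) =
      ∏ k, lpNorm (u k) 2 unitMeasure := by
  rw [lpNorm_two_sq (memLp_tensor hu).1]
  simp only [norm_prod, ← Finset.prod_pow]
  rw [integral_fintype_prod_eq_prod (f := fun k t => ‖u k t‖ ^ 2),
    Real.sqrt_prod _ fun k _ => integral_nonneg fun _ => sq_nonneg _]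
  exact Finset.prod_congr rfl fun k _ => (lpNorm_two_sq (hu k).1).symm

lemma integrable_tensor (hg : MemLp g 2 (volume.restrict (openCube (Fin s))))
    {u : Fin s → ℝ → ℂ} (hu : ∀ k, MemLp (u k) 2 unitMeasure) :
    Integrable (fun x => (g x : ℂ) * ∏ k, u k (x k)) (volume.restrict (openCube (Fin s))) := by
  rw [restrict_openCube] at hg ⊢
  exact MemLp.integrable_mul (𝕜 := ℂ) hg.ofReal (memLp_tensor hu)

lemma norm_tensorIntegral_le (hg : MemLp g 2 (volume.restrict (openCube (Fin s))))
    {u : Fin s → ℝ → ℂ} (hu : ∀ k, MemLp (u k) 2 unitMeasure) :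
    ‖tensorIntegral g u‖ ≤ lpNorm (fun x => (g x : ℂ)) 2 (volume.restrict (openCube (Fin s))) *
      ∏ k, lpNorm (u k) 2 unitMeasure := by
  rw [tensorIntegral, ← lpNorm_tensor hu]
  rw [restrict_openCube] at hg ⊢
  refine (norm_integral_le_integral_norm _).trans ?_
  simp only [norm_mul]
  exact integral_norm_mul_norm_le (hg.ofReal (K := ℂ)) (memLp_tensor hu)

lemma tensorIntegral_congr {u v : Fin s → ℝ → ℂ} (h : ∀ k, Set.EqOn (u k) (v k) (Set.Ioo 0 1)) :
    tensorIntegral g u = tensorIntegral g v := by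
  apply setIntegral_congr_fun (MeasurableSet.univ_pi fun _ => measurableSet_Ioo)
  intro x hx
  simp only
  rw [Finset.prod_congr rfl fun k _ => h k (hx k (Set.mem_univ k))]

lemma prod_update_eq (u : Fin s → ℝ → ℂ) (k : Fin s) (w : ℝ → ℂ) (x : Fin s → ℝ) :
    ∏ j, Function.update u k w j (x j) = w (x k) * ∏ j ∈ Finset.univ.erase k, u j (x j) := by
  rw [← Finset.mul_prod_erase _ _ (Finset.mem_univ k), Function.update_self]
  congr 1
  exact Finset.prod_congr rfl fun j hj => by rw [Function.update_of_ne (Finset.ne_of_mem_erase hj)]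

lemma memLp_update {u : Fin s → ℝ → ℂ} (hu : ∀ k, MemLp (u k) 2 unitMeasure) (k : Fin s)
    {w : ℝ → ℂ} (hw : MemLp w 2 unitMeasure) (j : Fin s) :
    MemLp (Function.update u k w j) 2 unitMeasure := by
  by_cases h : j = k
  · subst h; simpa using hw
  · rw [Function.update_of_ne h]; exact hu j

lemma isL2Functional_tensorIntegral (hg : MemLp g 2 (volume.restrict (openCube (Fin s))))
    {u : Fin s → ℝ → ℂ} (hu : ∀ k, MemLp (u k) 2 unitMeasure) (k : Fin s) :
    IsL2Functional fun w => tensorIntegral g (Function.update u k w) where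
  add v w hv hw := by
    have h1 := integrable_tensor hg (memLp_update hu k hv)
    have h2 := integrable_tensor hg (memLp_update hu k hw)
    rw [tensorIntegral, tensorIntegral, tensorIntegral, ← integral_add h1 h2]
    congr 1; ext x
    simp only [prod_update_eq, Pi.add_apply]
    ring
  smul c v _ := by
    rw [tensorIntegral, tensorIntegral, ← integral_const_mul]
    congr 1; ext x
    simp only [prod_update_eq, Pi.smul_apply, smul_eq_mul]
    ring
  bound := by
    refine ⟨lpNorm (fun x => (g x : ℂ)) 2 (volume.restrict (openCube (Fin s))) *
      ∏ j ∈ Finset.univ.erase k, lpNorm (u j) 2 unitMeasure, fun w hw => ?_⟩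
    refine (norm_tensorIntegral_le hg (memLp_update hu k hw)).trans_eq ?_
    rw [← Finset.mul_prod_erase _ _ (Finset.mem_univ k), Function.update_self,
      Finset.prod_congr rfl fun j hj => by rw [Function.update_of_ne (Finset.ne_of_mem_erase hj)]]
    ring

lemma tensorIntegral_update_congr (u : Fin s → ℝ → ℂ) (k : Fin s) {v w : ℝ → ℂ}
    (h : Set.EqOn v w (Set.Ioo 0 1)) :
    tensorIntegral g (Function.update u k v) = tensorIntegral g (Function.update u k w) := by
  apply tensorIntegral_congr
  intro j
  by_cases hj : j = k
  · subst hj; simpa using h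
  · simp only [Function.update_of_ne hj]; exact fun _ _ => rfl

lemma tensorIntegral_ofReal (φ : Fin s → ℝ → ℝ) :
    tensorIntegral g (fun k t => (φ k t : ℂ)) =
      ((∫ x in openCube (Fin s), g x * ∏ k, φ k (x k) : ℝ) : ℂ) := by
  rw [tensorIntegral, ← integral_complex_ofReal]
  congr 1; ext x
  push_cast; rfl

/-- `g'` is a weak partial derivative of `g` in the direction `i`, tested on tensor products. -/
def IsWeakPartial (i : Fin s) (g g' : (Fin s → ℝ) → ℝ) : Prop :=
  ∀ φ : Fin s → ℝ → ℝ, (∀ k, IsTest (φ k)) →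
    ∫ x in openCube (Fin s), g x * ∏ k, Function.update φ i (deriv (φ i)) k (x k) =
      -∫ x in openCube (Fin s), g' x * ∏ k, φ k (x k)

lemma exists_isTest_integral_eq_one : ∃ η : ℝ → ℝ, IsTest η ∧ ∫ t in (0 : ℝ)..1, η t = 1 := by
  let f : ContDiffBump (1 / 2 : ℝ) := ⟨1 / 4, 1 / 3, by norm_num, by norm_num⟩
  have hts : tsupport f ⊆ Set.Ioo 0 1 := by
    rw [f.tsupport_eq, Real.closedBall_eq_Icc]
    intro x hx
    change x ∈ Set.Icc (1 / 2 - (1 / 3 : ℝ)) (1 / 2 + 1 / 3) at hx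
    constructor <;> linarith [hx.1, hx.2]
  refine ⟨f.normed volume, ⟨f.contDiff_normed, f.hasCompactSupport_normed, ?_⟩, ?_⟩
  · rw [f.tsupport_normed_eq, ← f.tsupport_eq]; exact hts
  · rw [intervalIntegral.integral_eq_integral_of_support_subset, f.integral_normed]
    rw [f.support_normed_eq, ← f.support_eq]
    exact (subset_tsupport _).trans (hts.trans Set.Ioo_subset_Ioc_self)

/-- The primitive of a test function of mean zero is a test function. -/
lemma IsTest.primitive {φ : ℝ → ℝ} (hφ : IsTest φ) (h0 : ∫ t in (0 : ℝ)..1, φ t = 0) :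
    IsTest (fun x => ∫ t in (0 : ℝ)..x, φ t) ∧ deriv (fun x => ∫ t in (0 : ℝ)..x, φ t) = φ := by
  have hc := hφ.1.continuous
  have hderiv : ∀ x, HasDerivAt (fun x => ∫ t in (0 : ℝ)..x, φ t) (φ x) x := fun x =>
    intervalIntegral.integral_hasDerivAt_right (hc.intervalIntegrable _ _)
      (hc.stronglyMeasurableAtFilter _ _) hc.continuousAt
  have hd : deriv (fun x => ∫ t in (0 : ℝ)..x, φ t) = φ := funext fun x => (hderiv x).deriv
  have hi := fun a b => hc.intervalIntegrable (μ := volume) a b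
  -- the support of `φ` lies in some `[α, β]` with `0 < α` and `β < 1`
  obtain ⟨α, β, hα, hβ, hsub⟩ : ∃ α β : ℝ, 0 < α ∧ β < 1 ∧ tsupport φ ⊆ Set.Icc α β := by
    rcases (tsupport φ).eq_empty_or_nonempty with he | hne
    · exact ⟨1 / 2, 1 / 2, by norm_num, by norm_num, by rw [he]; exact Set.empty_subset _⟩
    · have hcomp : IsCompact (tsupport φ) := hφ.2.1
      obtain ⟨x, hx⟩ := hcomp.exists_isLeast hne
      obtain ⟨y, hy⟩ := hcomp.exists_isGreatest hne
      exact ⟨x, y, (hφ.2.2 hx.1).1, (hφ.2.2 hy.1).2, fun z hz => ⟨hx.2 hz, hy.2 hz⟩⟩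
  have hzero : ∀ t, t ∉ Set.Icc α β → φ t = 0 := fun t ht =>
    image_eq_zero_of_notMem_tsupport fun h => ht (hsub h)
  have hsupp : Function.support (fun x => ∫ t in (0 : ℝ)..x, φ t) ⊆ Set.Icc α β := by
    intro x hx
    by_contra hcon
    apply hx
    rw [Set.mem_Icc, not_and_or, not_le, not_le] at hcon
    rcases hcon with h | h
    · refine intervalIntegral.integral_zero_ae (Filter.Eventually.of_forall fun t ht => ?_)
      apply hzero
      intro hmem
      rcases le_total 0 x with h2 | h2
      · rw [Set.uIoc_of_le h2] at ht; linarith [ht.2, hmem.1]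
      · rw [Set.uIoc_of_ge h2] at ht; linarith [ht.2, hmem.1]
    · have : ∫ t in x..1, φ t = 0 := by
        refine intervalIntegral.integral_zero_ae (Filter.Eventually.of_forall fun t ht => ?_)
        apply hzero
        intro hmem
        rcases le_total x 1 with h2 | h2
        · rw [Set.uIoc_of_le h2] at ht; linarith [ht.1, hmem.2]
        · rw [Set.uIoc_of_ge h2] at ht; linarith [ht.1, hmem.2]
      rw [← intervalIntegral.integral_add_adjacent_intervals (hi 0 x) (hi x 1), this, add_zero] at h0
      exact h0
  refine ⟨⟨?_, ?_, ?_⟩, hd⟩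
  · rw [contDiff_infty_iff_deriv, hd]
    exact ⟨fun x => (hderiv x).differentiableAt, hφ.1⟩
  · exact HasCompactSupport.of_support_subset_isCompact isCompact_Icc hsupp
  · exact (closure_minimal hsupp isClosed_Icc).trans fun x hx => ⟨hα.trans_le hx.1, hx.2.trans_lt hβ⟩

/-- Integration by parts in the direction `i` against a tensor product of square integrable
functions.  Subtracting the mean makes the boundary terms vanish. -/
lemma IsWeakPartial.tensorIntegral_eq {i : Fin s} (h : IsWeakPartial i g g')
    (hg : MemLp g 2 (volume.restrict (openCube (Fin s))))
    (hg' : MemLp g' 2 (volume.restrict (openCube (Fin s))))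
    {u : Fin s → ℝ → ℂ} (hu : ∀ k, MemLp (u k) 2 unitMeasure) :
    tensorIntegral g u = mean (u i) * tensorIntegral g (Function.update u i 1) -
      tensorIntegral g' (Function.update u i (centeredPrimitive (u i))) := by
  obtain ⟨η, hη, hη1⟩ := exists_isTest_integral_eq_one
  set ηc : ℝ → ℂ := fun t => (η t : ℂ)
  set S : (ℝ → ℂ) → ℝ → ℂ := fun v => v - mean v • ηc with hS
  set R : (ℝ → ℂ) → ℝ → ℂ := fun v x => ∫ t in (0 : ℝ)..x, v t with hR
  have hSop : IsL2Operator S := isL2Operator_sub_mean hη.memLp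
  have hRop : IsL2Operator R := isL2Operator_primitive
  set D : (Fin s → ℝ → ℂ) → ℂ := fun u => tensorIntegral g (Function.update u i (S (u i))) +
    tensorIntegral g' (Function.update u i (R (S (u i)))) with hDdef
  have hD0 : ∀ u, (∀ k, MemLp (u k) 2 unitMeasure) → D u = 0 := by
    intro u hu
    refine eq_zero_of_separately (D := D) ?_ ?_ hu
    · intro u hu k
      by_cases hk : k = i
      · subst hk
        have h1 : IsL2Functional fun w => tensorIntegral g (Function.update u k (S w)) :=
          (isL2Functional_tensorIntegral hg hu k).comp
            (fun v w hvw => tensorIntegral_update_congr u k hvw) hSop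
        have h2 : IsL2Functional fun w => tensorIntegral g' (Function.update u k (R w)) :=
          (isL2Functional_tensorIntegral hg' hu k).comp
            (fun v w hvw => tensorIntegral_update_congr u k hvw) hRop
        have h3 : IsL2Functional fun w => tensorIntegral g' (Function.update u k (R (S w))) := by
          refine h2.comp (fun v w hvw => ?_) hSop
          apply tensorIntegral_update_congr
          intro x hx
          apply intervalIntegral.integral_congr_ae
          refine Filter.Eventually.of_forall fun t ht => hvw ?_
          rw [Set.uIoc_of_le hx.1.le] at ht
          exact ⟨ht.1, ht.2.trans_lt hx.2⟩
        simpa only [hDdef, Function.update_self, Function.update_idem] using h1.add' h3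
      · have hcomm : ∀ w, D (Function.update u k w) =
            tensorIntegral g (Function.update (Function.update u i (S (u i))) k w) +
            tensorIntegral g' (Function.update (Function.update u i (R (S (u i)))) k w) := by
          intro w
          simp only [hDdef, Function.update_of_ne (Ne.symm hk)]
          rw [Function.update_comm hk, Function.update_comm hk]
        simp only [hcomm]
        exact (isL2Functional_tensorIntegral hg
          (memLp_update hu i (hSop.memLp _ (hu i))) k).add'
          (isL2Functional_tensorIntegral hg'
          (memLp_update hu i (hRop.memLp _ (hSop.memLp _ (hu i)))) k)
    · intro φ hφ
      set m : ℝ := ∫ t in (0 : ℝ)..1, φ i t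
      set ψ : ℝ → ℝ := fun t => φ i t - m * η t with hψdef
      have hψ : IsTest ψ := by
        refine ⟨(hφ i).1.sub (contDiff_const.mul hη.1), (hφ i).2.1.sub hη.2.1.mul_left, ?_⟩
        have : tsupport ψ ⊆ tsupport (φ i) ∪ tsupport η := by
          refine (tsupport_sub (φ i) (fun t => m * η t)).trans
            (Set.union_subset_union_right _ (closure_mono ?_))
          exact Function.support_mul_subset_right _ _
        exact this.trans (Set.union_subset (hφ i).2.2 hη.2.2)
      have hψ0 : ∫ t in (0 : ℝ)..1, ψ t = 0 := by
        rw [hψdef, intervalIntegral.integral_sub ((hφ i).1.continuous.intervalIntegrable _ _)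
          ((hη.1.continuous.intervalIntegrable _ _).const_mul m),
          intervalIntegral.integral_const_mul, hη1, mul_one, sub_self]
      obtain ⟨hΨ, hΨd⟩ := hψ.primitive hψ0
      have hSφ : S (fun t => (φ i t : ℂ)) = fun t => (ψ t : ℂ) := by
        ext t
        have : mean (fun t => (φ i t : ℂ)) = (m : ℂ) := intervalIntegral.integral_ofReal
        simp [hS, this, hψdef, ηc]
      have hRφ : R (fun t => (ψ t : ℂ)) = fun x => ((∫ t in (0 : ℝ)..x, ψ t : ℝ) : ℂ) := by
        ext x
        exact intervalIntegral.integral_ofReal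
      have hup : ∀ χ : ℝ → ℝ, Function.update (fun k t => ((φ k t : ℝ) : ℂ)) i
          (fun t => (χ t : ℂ)) = fun k t => ((Function.update φ i χ k t : ℝ) : ℂ) := by
        intro χ
        ext k t
        by_cases hk : k = i
        · subst hk; simp
        · simp [Function.update_of_ne hk]
      have := h (Function.update φ i fun x => ∫ t in (0 : ℝ)..x, ψ t) (fun k => by
        by_cases hk : k = i
        · subst hk; simpa using hΨ
        · rw [Function.update_of_ne hk]; exact hφ k)
      simp only [Function.update_self, Function.update_idem, hΨd] at this
      simp only [hDdef]
      rw [hSφ, hRφ, hup, hup, tensorIntegral_ofReal, tensorIntegral_ofReal, this]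
      push_cast
      ring
  -- apply the identity to the tuple whose `i`-th entry is centered
  have h1m : MemLp (1 : ℝ → ℂ) 2 unitMeasure := memLp_const _
  set w : ℝ → ℂ := u i - mean (u i) • 1 with hw
  have hwm : MemLp w 2 unitMeasure := (hu i).sub (h1m.const_smul _)
  have hmean : mean w = 0 := by
    have : mean w = mean (u i) - ∫ _t in (0 : ℝ)..1, mean (u i) := by
      rw [mean, mean, ← intervalIntegral.integral_sub (MemLp.intervalIntegrable_unit (hu i)) (by simp)]
      simp [hw, mean]
    rw [this]; simp
  have hfin := hD0 (Function.update u i w) (memLp_update hu i hwm)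
  have hSw : S w = w := by simp [hS, hmean]
  have hRw : R w = centeredPrimitive (u i) := by
    ext x
    simp [hR, hw, centeredPrimitive]
  simp only [hDdef, Function.update_self, Function.update_idem, hSw, hRw] at hfin
  have hL := isL2Functional_tensorIntegral hg hu i
  have hadd := hL.add w (mean (u i) • 1) hwm (h1m.const_smul _)
  rw [hL.smul _ _ h1m, hw, sub_add_cancel, Function.update_eq_self, ← hw] at hadd
  rw [hadd]
  linear_combination hfin

end TensorIntegral

/-! ### Weak derivatives and the Sobolev bound -/

section WeakDeriv

variable {s : ℕ}

lemma fderiv_tensor_single {φ : Fin s → ℝ → ℝ} (hφ : ∀ k, ContDiff ℝ ∞ (φ k)) (i : Fin s)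
    (x : Fin s → ℝ) :
    fderiv ℝ (fun x => ∏ k, φ k (x k)) x (Pi.single i 1) =
      ∏ k, Function.update φ i (deriv (φ i)) k (x k) := by
  have hdiff : DifferentiableAt ℝ (fun x : Fin s → ℝ => ∏ k, φ k (x k)) x := by
    have : ContDiff ℝ ∞ (fun x : Fin s → ℝ => ∏ k, φ k (x k)) :=
      contDiff_prod fun k _ => (hφ k).comp (contDiff_apply ℝ ℝ k)
    exact this.differentiable (by simp) x
  have h1 := hdiff.hasFDerivAt.hasLineDerivAt (Pi.single i 1)
  have h2 : HasDerivAt (fun t : ℝ => φ i (x i + t) * ∏ j ∈ Finset.univ.erase i, φ j (x j))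
      (deriv (φ i) (x i) * ∏ j ∈ Finset.univ.erase i, φ j (x j)) 0 := by
    refine HasDerivAt.mul_const ?_ _
    have h3 : HasDerivAt (φ i) (deriv (φ i) (x i + 0)) (x i + 0) :=
      ((hφ i).differentiable (by simp) _).hasDerivAt
    have := h3.comp_const_add (x i) 0
    rwa [add_zero] at this
  have h4 : (fun t : ℝ => ∏ k, φ k ((x + t • (Pi.single i 1 : Fin s → ℝ)) k)) =
      fun t : ℝ => φ i (x i + t) * ∏ j ∈ Finset.univ.erase i, φ j (x j) := by
    ext t
    rw [← Finset.mul_prod_erase _ _ (Finset.mem_univ i)]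
    congr 1
    · simp
    · exact Finset.prod_congr rfl fun j hj => by simp [Pi.single_eq_of_ne (Finset.ne_of_mem_erase hj)]
  have h5 : HasDerivAt (fun t : ℝ => ∏ k, φ k ((x + t • (Pi.single i 1 : Fin s → ℝ)) k))
      (fderiv ℝ (fun x => ∏ k, φ k (x k)) x (Pi.single i 1)) 0 := h1
  rw [h4] at h5
  rw [h5.unique h2, ← Finset.mul_prod_erase _ _ (Finset.mem_univ i), Function.update_self]
  congr 1
  exact Finset.prod_congr rfl fun j hj => by rw [Function.update_of_ne (Finset.ne_of_mem_erase hj)]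

lemma iterate_fderiv_tensor {φ : Fin s → ℝ → ℝ} (hφ : ∀ k, ContDiff ℝ ∞ (φ k)) (i : Fin s)
    (m : ℕ) :
    (fun (u : (Fin s → ℝ) → ℝ) x => fderiv ℝ u x (Pi.single i 1))^[m] (fun x => ∏ k, φ k (x k)) =
      fun x => ∏ k, Function.update φ i (deriv^[m] (φ i)) k (x k) := by
  induction m with
  | zero => simp
  | succ m ih =>
    rw [Function.iterate_succ_apply', ih]
    ext x
    rw [fderiv_tensor_single]
    · simp [Function.iterate_succ_apply']
    · intro k
      by_cases hk : k = i
      · subst hk; simpa using ContDiff.iterate_deriv m (hφ k)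
      · rw [Function.update_of_ne hk]; exact hφ k

lemma smoothPartial_tensor {φ : Fin s → ℝ → ℝ} (hφ : ∀ k, ContDiff ℝ ∞ (φ k)) (τ : Fin s → ℕ) :
    smoothPartial τ (fun x => ∏ k, φ k (x k)) = fun x => ∏ k, deriv^[τ k] (φ k) (x k) := by
  have key : ∀ l : List (Fin s), l.Nodup →
      l.foldr (fun i g => (fun u x => fderiv ℝ u x (Pi.single i 1))^[τ i] g)
        (fun x => ∏ k, φ k (x k)) =
      fun x => ∏ k, (if k ∈ l then deriv^[τ k] (φ k) else φ k) (x k) := by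
    intro l hl
    induction l with
    | nil => simp
    | cons i l ih =>
      rw [List.nodup_cons] at hl
      rw [List.foldr_cons, ih hl.2, iterate_fderiv_tensor (φ := fun k =>
        if k ∈ l then deriv^[τ k] (φ k) else φ k)]
      · ext x
        refine Finset.prod_congr rfl fun k _ => ?_
        by_cases hk : k = i
        · subst hk; simp [hl.1]
        · simp [hk]
      · intro k
        split_ifs
        · exact ContDiff.iterate_deriv _ (hφ k)
        · exact hφ k
  rw [smoothPartial, key _ (List.nodup_finRange s)]
  simp

lemma IsTest.deriv {φ : ℝ → ℝ} (hφ : IsTest φ) : IsTest (deriv φ) :=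
  ⟨(contDiff_infty_iff_deriv.mp hφ.1).2, hφ.2.1.deriv, (tsupport_deriv_subset).trans hφ.2.2⟩

/-- A tensor product of test functions is an admissible test function on the open cube. -/
lemma tensor_isTest {φ : Fin s → ℝ → ℝ} (hφ : ∀ k, IsTest (φ k)) :
    ContDiff ℝ ∞ (fun x : Fin s → ℝ => ∏ k, φ k (x k)) ∧
    HasCompactSupport (fun x : Fin s → ℝ => ∏ k, φ k (x k)) ∧
    tsupport (fun x : Fin s → ℝ => ∏ k, φ k (x k)) ⊆ openCube (Fin s) := by
  have hcomp : IsCompact (Set.univ.pi fun k => tsupport (φ k)) :=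
    isCompact_univ_pi fun k => (hφ k).2.1
  have hsub : Function.support (fun x : Fin s → ℝ => ∏ k, φ k (x k)) ⊆
      Set.univ.pi fun k => tsupport (φ k) := by
    intro x hx k _
    by_contra hk
    exact hx (Finset.prod_eq_zero (Finset.mem_univ k) (image_eq_zero_of_notMem_tsupport hk))
  refine ⟨contDiff_prod fun k _ => (hφ k).1.comp (contDiff_apply ℝ ℝ k),
    HasCompactSupport.of_support_subset_isCompact hcomp hsub,
    (closure_minimal hsub hcomp.isClosed).trans fun x hx k hk => (hφ k).2.2 (hx k hk)⟩

lemma isTest_update {φ : Fin s → ℝ → ℝ} (hφ : ∀ k, IsTest (φ k)) (i : Fin s) {ψ : ℝ → ℝ}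
    (hψ : IsTest ψ) (k : Fin s) : IsTest (Function.update φ i ψ k) := by
  by_cases hk : k = i
  · subst hk; simpa using hψ
  · rw [Function.update_of_ne hk]; exact hφ k

/-- The weak derivative of multi-index `τ + e_i` is a weak partial derivative of the one of
multi-index `τ`. -/
lemma IsWeakDeriv.isWeakPartial {τ : Fin s → ℕ} {i : Fin s} {f g g' : (Fin s → ℝ) → ℝ}
    (h : IsWeakDeriv τ f g) (h' : IsWeakDeriv (Function.update τ i (τ i + 1)) f g') :
    IsWeakPartial i g g' := by
  intro φ hφ
  have hup := isTest_update hφ i (hφ i).deriv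
  obtain ⟨a1, a2, a3⟩ := tensor_isTest hup
  obtain ⟨b1, b2, b3⟩ := tensor_isTest hφ
  have e1 := h.2 _ a1 a2 a3
  have e2 := h'.2 _ b1 b2 b3
  rw [smoothPartial_tensor fun k => (hup k).1] at e1
  rw [smoothPartial_tensor fun k => (hφ k).1] at e2
  have heq : (fun x : Fin s → ℝ => ∏ k, deriv^[τ k] (Function.update φ i (deriv (φ i)) k) (x k)) =
      fun x => ∏ k, deriv^[Function.update τ i (τ i + 1) k] (φ k) (x k) := by
    ext x
    refine Finset.prod_congr rfl fun k _ => ?_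
    by_cases hk : k = i
    · subst hk; simp
    · simp [Function.update_of_ne hk]
  have hsum : ∑ k, Function.update τ i (τ i + 1) k = (∑ k, τ k) + 1 := by
    rw [Finset.sum_update_of_mem (Finset.mem_univ i), ← Finset.add_sum_erase _ τ (Finset.mem_univ i),
      Finset.sdiff_singleton_eq_erase]
    ring
  simp only [funext_iff] at heq
  simp only [heq] at e1
  rw [e2, hsum, pow_succ] at e1
  have hne : ((-1 : ℝ) ^ (∑ k, τ k)) ≠ 0 := pow_ne_zero _ (by norm_num)
  have := mul_left_cancel₀ hne (a := (-1 : ℝ) ^ (∑ k, τ k)) (b := ∫ x in openCube (Fin s),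
    g x * ∏ k, Function.update φ i (_root_.deriv (φ i)) k (x k))
    (c := -∫ x in openCube (Fin s), g' x * ∏ k, φ k (x k)) (by rw [← e1]; ring)
  exact this

/-- `f` and a weak derivative of order zero have the same integrals against tensor products. -/
lemma IsWeakDeriv.tensorIntegral_eq {f g : (Fin s → ℝ) → ℝ}
    (hf : MemLp f 2 (volume.restrict (openCube (Fin s)))) (h : IsWeakDeriv 0 f g)
    {u : Fin s → ℝ → ℂ} (hu : ∀ k, MemLp (u k) 2 unitMeasure) :
    tensorIntegral f u = tensorIntegral g u := by
  have := eq_zero_of_separately (D := fun u => tensorIntegral f u + -tensorIntegral g u)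
    (fun u hu k => (isL2Functional_tensorIntegral hf hu k).add'
      (isL2Functional_tensorIntegral h.1 hu k).neg) (fun φ hφ => ?_) hu
  · exact eq_of_sub_eq_zero (by rw [sub_eq_add_neg]; exact this)
  · obtain ⟨b1, b2, b3⟩ := tensor_isTest hφ
    have e := h.2 _ b1 b2 b3
    rw [smoothPartial_tensor fun k => (hφ k).1] at e
    simp only [Pi.zero_apply, Function.iterate_zero, id_eq, Finset.sum_const_zero, pow_zero,
      one_mul] at e
    rw [tensorIntegral_ofReal, tensorIntegral_ofReal, e, add_neg_cancel]

lemma memLp_centeredPrimitive {u : ℝ → ℂ} (hu : MemLp u 2 unitMeasure) :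
    MemLp (centeredPrimitive u) 2 unitMeasure :=
  memLp_primitive (hu.sub (memLp_const _))

lemma memLp_iterate_centeredPrimitive {u : ℝ → ℂ} (hu : MemLp u 2 unitMeasure) (r : ℕ) :
    MemLp (centeredPrimitive^[r] u) 2 unitMeasure := by
  induction r with
  | zero => exact hu
  | succ r ih => rw [Function.iterate_succ_apply']; exact memLp_centeredPrimitive ih

/-- Repeated integration by parts in the direction `i`. -/
lemma tensorIntegral_expand {n : ℕ} {G : (Fin s → ℕ) → (Fin s → ℝ) → ℝ}
    (hG : ∀ τ, (∀ k, τ k ≤ n) → MemLp (G τ) 2 (volume.restrict (openCube (Fin s))))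
    (hpart : ∀ τ i, (∀ k, τ k ≤ n) → τ i < n →
      IsWeakPartial i (G τ) (G (Function.update τ i (τ i + 1))))
    {τ : Fin s → ℕ} (hτ : ∀ k, τ k ≤ n) {i : Fin s} (hi : τ i = 0)
    {u : Fin s → ℝ → ℂ} (hu : ∀ k, MemLp (u k) 2 unitMeasure) {R : ℕ} (hR : R ≤ n) :
    tensorIntegral (G τ) u =
      (∑ r ∈ Finset.range R, (-1) ^ r * mean (centeredPrimitive^[r] (u i)) *
        tensorIntegral (G (Function.update τ i r)) (Function.update u i 1)) +
      (-1) ^ R * tensorIntegral (G (Function.update τ i R))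
        (Function.update u i (centeredPrimitive^[R] (u i))) := by
  have hle : ∀ r ≤ n, ∀ k, Function.update τ i r k ≤ n := by
    intro r hr k
    by_cases hk : k = i
    · subst hk; simpa using hr
    · rw [Function.update_of_ne hk]; exact hτ k
  induction R with
  | zero =>
    have h0 : Function.update τ i 0 = τ := by rw [← hi, Function.update_eq_self]
    simp [h0]
  | succ R ih =>
    have hstep := (hpart (Function.update τ i R) i (hle R (by omega)) (by
      rw [Function.update_self]; omega)).tensorIntegral_eq (hG _ (hle R (by omega)))
      (hG _ (by rw [Function.update_self, Function.update_idem]; exact hle _ hR))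
      (memLp_update hu i (memLp_iterate_centeredPrimitive (hu i) R))
    simp only [Function.update_self, Function.update_idem] at hstep
    rw [ih (by omega), hstep, Finset.sum_range_succ, Function.iterate_succ_apply', pow_succ]
    ring

/-- A bound on the terms in which every coordinate is either averaged or fully differentiated
gives a bound on a general tensor integral. -/
lemma norm_tensorIntegral_le_of_terminal {n : ℕ} {G : (Fin s → ℕ) → (Fin s → ℝ) → ℝ}
    (hG : ∀ τ, (∀ k, τ k ≤ n) → MemLp (G τ) 2 (volume.restrict (openCube (Fin s))))
    (hpart : ∀ τ i, (∀ k, τ k ≤ n) → τ i < n →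
      IsWeakPartial i (G τ) (G (Function.update τ i (τ i + 1)))) {B : ℝ}
    (hB : ∀ τ, (∀ k, τ k ≤ n) → ∀ u : Fin s → ℝ → ℂ,
      (∀ k, (τ k < n ∧ u k = 1) ∨ (τ k = n ∧ MemLp (u k) 2 unitMeasure ∧
        ∀ x ∈ Set.Ioo (0 : ℝ) 1, ‖u k x‖ ≤ 1)) → ‖tensorIntegral (G τ) u‖ ≤ B)
    {w : Fin s → ℝ → ℂ} (hw : ∀ k, MemLp (w k) 2 unitMeasure) {M : Fin s → ℝ} (hM : ∀ k, 0 < M k)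
    (hmean : ∀ k, ∀ r < n, ‖mean (centeredPrimitive^[r] (w k))‖ ≤ M k)
    (hlast : ∀ k, ∀ x ∈ Set.Ioo (0 : ℝ) 1, ‖centeredPrimitive^[n] (w k) x‖ ≤ M k) :
    ‖tensorIntegral (G 0) w‖ ≤ B * ∏ k, ((n + 1) * M k) := by
  have key : ∀ F : Finset (Fin s), ∀ τ, (∀ k, τ k ≤ n) → ∀ u : Fin s → ℝ → ℂ,
      (∀ k ∈ F, τ k = 0 ∧ u k = w k) →
      (∀ k ∉ F, (τ k < n ∧ u k = 1) ∨ (τ k = n ∧ MemLp (u k) 2 unitMeasure ∧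
        ∀ x ∈ Set.Ioo (0 : ℝ) 1, ‖u k x‖ ≤ 1)) →
      ‖tensorIntegral (G τ) u‖ ≤ B * ∏ k ∈ F, ((n + 1) * M k) := by
    intro F
    induction F using Finset.induction_on with
    | empty =>
      intro τ hτ u _ h2
      rw [Finset.prod_empty, mul_one]
      exact hB τ hτ u fun k => h2 k (Finset.notMem_empty k)
    | insert i F hi ih =>
      intro τ hτ u h1 h2
      have hu : ∀ k, MemLp (u k) 2 unitMeasure := by
        intro k
        by_cases hk : k ∈ insert i F
        · rw [(h1 k hk).2]; exact hw k
        · rcases h2 k hk with h | h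
          · rw [h.2]; exact memLp_const _
          · exact h.2.1
      obtain ⟨hτi, hui⟩ := h1 i (Finset.mem_insert_self i F)
      have hle : ∀ r ≤ n, ∀ k, Function.update τ i r k ≤ n := by
        intro r hr k
        by_cases hk : k = i
        · subst hk; simpa using hr
        · rw [Function.update_of_ne hk]; exact hτ k
      set Q := B * ∏ k ∈ F, ((n + 1) * M k) with hQ
      have hF : ∀ r (v : ℝ → ℂ), ∀ k ∈ F, Function.update τ i r k = 0 ∧
          Function.update u i v k = w k := by
        intro r v k hk
        have hki : k ≠ i := ne_of_mem_of_not_mem hk hi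
        rw [Function.update_of_ne hki, Function.update_of_ne hki]
        exact h1 k (Finset.mem_insert_of_mem hk)
      have hb1 : ∀ r < n, ‖tensorIntegral (G (Function.update τ i r)) (Function.update u i 1)‖ ≤ Q := by
        intro r hr
        refine ih _ (hle r hr.le) _ (hF r 1) fun k hk => ?_
        by_cases hki : k = i
        · subst hki; left; simpa using hr
        · rw [Function.update_of_ne hki, Function.update_of_ne hki]
          exact h2 k (by simp [hk, hki])
      have hb2 : ‖tensorIntegral (G (Function.update τ i n))
          (Function.update u i (centeredPrimitive^[n] (u i)))‖ ≤ M i * Q := by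
        set v := centeredPrimitive^[n] (u i) with hv
        have hvm : MemLp v 2 unitMeasure := memLp_iterate_centeredPrimitive (hu i) n
        have hMi : (M i : ℂ) ≠ 0 := by exact_mod_cast (hM i).ne'
        have hsplit : v = (M i : ℂ) • ((M i : ℂ)⁻¹ • v) := by rw [smul_smul, mul_inv_cancel₀ hMi, one_smul]
        have hvm' : MemLp ((M i : ℂ)⁻¹ • v) 2 unitMeasure := hvm.const_smul _
        rw [hsplit, (isL2Functional_tensorIntegral (hG _ (hle n le_rfl)) hu i).smul _ _ hvm', norm_mul,
          Complex.norm_real, Real.norm_eq_abs, abs_of_pos (hM i)]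
        refine mul_le_mul_of_nonneg_left ?_ (hM i).le
        refine ih _ (hle n le_rfl) _ (hF n _) fun k hk => ?_
        by_cases hki : k = i
        · subst hki
          right
          simp only [Function.update_self]
          refine ⟨trivial, hvm', fun x hx => ?_⟩
          rw [Pi.smul_apply, norm_smul, norm_inv, Complex.norm_real, Real.norm_eq_abs,
            abs_of_pos (hM k), inv_mul_le_iff₀ (hM k), mul_one, hv, hui]
          exact hlast k x hx
        · rw [Function.update_of_ne hki, Function.update_of_ne hki]
          exact h2 k (by simp [hk, hki])
      rw [tensorIntegral_expand hG hpart hτ hτi hu le_rfl, Finset.prod_insert hi]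
      refine (norm_add_le _ _).trans ?_
      have hs1 : ‖∑ r ∈ Finset.range n, (-1) ^ r * mean (centeredPrimitive^[r] (u i)) *
          tensorIntegral (G (Function.update τ i r)) (Function.update u i 1)‖ ≤ n * (M i * Q) := by
        refine (norm_sum_le _ _).trans ?_
        refine (Finset.sum_le_card_nsmul _ _ (M i * Q) fun r hr => ?_).trans_eq (by simp)
        rw [Finset.mem_range] at hr
        rw [norm_mul, norm_mul, norm_pow, norm_neg, norm_one, one_pow, one_mul, hui]
        exact mul_le_mul (hmean i r hr) (hb1 r hr) (norm_nonneg _) (hM i).le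
      have hs2 : ‖(-1) ^ n * tensorIntegral (G (Function.update τ i n))
          (Function.update u i (centeredPrimitive^[n] (u i)))‖ ≤ M i * Q := by
        rw [norm_mul, norm_pow, norm_neg, norm_one, one_pow, one_mul]; exact hb2
      refine (add_le_add hs1 hs2).trans_eq ?_
      rw [hQ]; ring
  exact key Finset.univ 0 (fun _ => Nat.zero_le _) w (fun _ _ => ⟨rfl, rfl⟩)
    (fun k hk => absurd (Finset.mem_univ k) hk)

end WeakDeriv

section SobolevBound

variable {s : ℕ}

lemma sq_integral_le_of_memLp {α : Type*} [MeasurableSpace α] {μ : Measure α}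
    [IsProbabilityMeasure μ] {f : α → ℝ} (hf : MemLp f 2 μ) :
    (∫ x, f x ∂μ) ^ 2 ≤ ∫ x, f x ^ 2 ∂μ := by
  have h := ProbabilityTheory.variance_nonneg f μ
  rw [ProbabilityTheory.variance_eq_sub hf] at h
  simpa using h

/-- The terms in which each coordinate is averaged (`τ k < n`) or fully differentiated (`τ k = n`)
are bounded by the corresponding term of the norm. -/
lemma norm_tensorIntegral_le_smoothNorm_term {n : ℕ} (τ : Fin s → Fin (n + 1))
    {g : (Fin s → ℝ) → ℝ} (hg : MemLp g 2 (volume.restrict (openCube (Fin s))))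
    {u : Fin s → ℝ → ℂ}
    (hu : ∀ k, ((τ k : ℕ) < n ∧ u k = 1) ∨ ((τ k : ℕ) = n ∧ MemLp (u k) 2 unitMeasure ∧
        ∀ x ∈ Set.Ioo (0 : ℝ) 1, ‖u k x‖ ≤ 1)) :
    ‖tensorIntegral g u‖ ^ 2 ≤ ∫ y in openCube {i // (τ i : ℕ) = n},
      (∫ z in openCube {i // ¬ (τ i : ℕ) = n},
        g (fun i => if h : (τ i : ℕ) = n then y ⟨i, h⟩ else z ⟨i, h⟩)) ^ 2 := by
  have hum : ∀ k, MemLp (u k) 2 unitMeasure := fun k => by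
    rcases hu k with h | h
    · rw [h.2]; exact memLp_const _
    · exact h.2.1
  have hint := integrable_tensor hg hum
  rw [tensorIntegral]
  rw [restrict_openCube] at hint hg ⊢
  rw [restrict_openCube, restrict_openCube]
  set p : Fin s → Prop := fun i => (τ i : ℕ) = n with hp
  set e := MeasurableEquiv.piEquivPiSubtypeProd (fun _ : Fin s => ℝ) p with he
  have hmp := (measurePreserving_piEquivPiSubtypeProd (fun _ : Fin s => unitMeasure) p).symm
  set μ₁ : Measure ({i // p i} → ℝ) := Measure.pi fun _ => unitMeasure
  set μ₂ : Measure ({i // ¬ p i} → ℝ) := Measure.pi fun _ => unitMeasure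
  set c : ({i // p i} → ℝ) → ({i // ¬ p i} → ℝ) → Fin s → ℝ :=
    fun y z i => if h : p i then y ⟨i, h⟩ else z ⟨i, h⟩ with hc
  have hec : ∀ q, e.symm q = c q.1 q.2 := fun q => rfl
  -- the product depends on the fully differentiated coordinates only
  set U : ({i // p i} → ℝ) → ℂ := fun y => ∏ k : {i // p i}, u k (y k) with hU
  have hprod : ∀ y z, ∏ k, u k (c y z k) = U y := by
    intro y z
    rw [← Fintype.prod_subtype_mul_prod_subtype p]
    have h2 : ∏ k : {i // ¬ p i}, u k (c y z k) = 1 := by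
      refine Finset.prod_eq_one fun k _ => ?_
      rcases hu k with h | h
      · rw [h.2]; rfl
      · exact absurd h.1 k.2
    rw [h2, mul_one]
    refine Finset.prod_congr rfl fun k _ => ?_
    simp only [hc, dif_pos k.2]
  have hgc : MemLp (fun q : ({i // p i} → ℝ) × ({i // ¬ p i} → ℝ) => g (c q.1 q.2)) 2
      (μ₁.prod μ₂) := hg.comp_measurePreserving hmp
  have hg2 := (memLp_two_iff_integrable_sq hgc.1).mp hgc
  have hI : Integrable (fun q : ({i // p i} → ℝ) × ({i // ¬ p i} → ℝ) =>
      (g (c q.1 q.2) : ℂ) * U q.1) (μ₁.prod μ₂) := by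
    have := hmp.integrable_comp_of_integrable hint
    refine this.congr (Filter.Eventually.of_forall fun q => ?_)
    simp only [Function.comp]
    rw [← hprod q.1 q.2]
    rfl
  set h : ({i // p i} → ℝ) → ℝ := fun y => ∫ z, g (c y z) ∂μ₂ with hh
  have hm : AEStronglyMeasurable h μ₁ := hgc.1.integral_prod_right'
  have hsec : ∀ᵐ y ∂μ₁, MemLp (fun z => g (c y z)) 2 μ₂ := by
    filter_upwards [hg2.prod_right_ae, hgc.1.prodMk_left] with y h1 h2
    exact (memLp_two_iff_integrable_sq h2).mpr h1
  have hh2 : MemLp h 2 μ₁ := by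
    rw [memLp_two_iff_integrable_sq hm]
    refine hg2.integral_prod_left.mono' (hm.pow 2) ?_
    filter_upwards [hsec] with y hy
    rw [Real.norm_eq_abs, abs_of_nonneg (sq_nonneg _)]
    exact sq_integral_le_of_memLp hy
  have hval : ∫ x, (g x : ℂ) * ∏ k, u k (x k) ∂(Measure.pi fun _ : Fin s => unitMeasure) =
      ∫ y, U y * (h y : ℂ) ∂μ₁ := by
    rw [← hmp.integral_comp' (fun x => (g x : ℂ) * ∏ k, u k (x k))]
    have : (fun q => ((g (e.symm q) : ℝ) : ℂ) * ∏ k, u k (e.symm q k)) =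
        fun q => (g (c q.1 q.2) : ℂ) * U q.1 := by
      ext q
      rw [hec, hprod]
    rw [this, integral_prod _ hI]
    congr 1; ext y
    dsimp only
    rw [integral_mul_const, integral_complex_ofReal, mul_comm]
  have hUle : ∀ᵐ y ∂μ₁, ‖U y‖ ≤ 1 := by
    have : ∀ᵐ y ∂μ₁, ∀ k : {i // p i}, y k ∈ Set.Ioo (0 : ℝ) 1 := by
      rw [ae_all_iff]
      intro k
      exact Measure.tendsto_eval_ae_ae (ae_restrict_mem measurableSet_Ioo)
    filter_upwards [this] with y hy
    rw [hU, norm_prod]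
    refine Finset.prod_le_one (fun _ _ => norm_nonneg _) fun k _ => ?_
    rcases hu k with h | h
    · rw [h.2]; simp
    · exact h.2.2 _ (hy k)
  rw [hval]
  have habs : ‖∫ y, U y * (h y : ℂ) ∂μ₁‖ ≤ ∫ y, |h y| ∂μ₁ := by
    refine norm_integral_le_of_norm_le (hh2.integrable (by norm_num)).abs ?_
    filter_upwards [hUle] with y hy
    rw [norm_mul, Complex.norm_real, Real.norm_eq_abs]
    exact mul_le_of_le_one_left (abs_nonneg _) hy
  refine (pow_le_pow_left₀ (norm_nonneg _) habs 2).trans ?_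
  have hha : MemLp (fun y => |h y|) 2 μ₁ := hh2.abs
  refine (sq_integral_le_of_memLp hha).trans_eq ?_
  simp only [sq_abs]
  rfl

lemma norm_tensorIntegral_le_smoothNorm {n : ℕ} {f : (Fin s → ℝ) → ℝ} {τ : Fin s → ℕ}
    (hτ : ∀ k, τ k ≤ n)
    (hg : MemLp (weakDeriv τ f) 2 (volume.restrict (openCube (Fin s))))
    {u : Fin s → ℝ → ℂ}
    (hu : ∀ k, (τ k < n ∧ u k = 1) ∨ (τ k = n ∧ MemLp (u k) 2 unitMeasure ∧
        ∀ x ∈ Set.Ioo (0 : ℝ) 1, ‖u k x‖ ≤ 1)) :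
    ‖tensorIntegral (weakDeriv τ f) u‖ ≤ smoothNorm n f := by
  rw [smoothNorm]
  apply Real.le_sqrt_of_sq_le
  set τ' : Fin s → Fin (n + 1) := fun k => ⟨τ k, Nat.lt_succ_of_le (hτ k)⟩
  refine (norm_tensorIntegral_le_smoothNorm_term τ' hg hu).trans ?_
  refine Finset.single_le_sum (f := fun τ : Fin s → Fin (n + 1) =>
    ∫ y in openCube {i // (τ i : ℕ) = n},
      (∫ z in openCube {i // ¬ (τ i : ℕ) = n},
        weakDeriv (fun i => (τ i : ℕ)) f
          (fun i => if h : (τ i : ℕ) = n then y ⟨i, h⟩ else z ⟨i, h⟩)) ^ 2)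
    (fun τ _ => integral_nonneg fun _ => sq_nonneg _) (Finset.mem_univ τ')

lemma dickWeight_eq_sum {b n : ℕ} (A : DigitMatrix b s n) :
    dickWeight A = ∑ i, rowWeight (A i) := rfl

lemma hammingWeight_eq_sum {b n : ℕ} (A : DigitMatrix b s n) :
    hammingWeight A = ∑ i, rowCount (A i) := rfl

lemma memLp_walsh {b n : ℕ} [NeZero b] (a : Fin n → ZMod b) : MemLp (walsh a) 2 unitMeasure :=
  memLp_of_bound (measurable_walsh a).aestronglyMeasurable fun x _ => (norm_walsh a x).le

/-- The Walsh coefficients of an `n`-smooth function decay with the Dick weight. -/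
lemma norm_fourierCoeff_le {b n : ℕ} [NeZero b] (hb : 1 ≤ b) {f : (Fin s → ℝ) → ℝ}
    (hf : IsNSmooth n f) (A : DigitMatrix b s n) :
    ‖fourierCoeff (discretization f) A‖ ≤
      ((n + 1) * (2 * b) ^ n : ℝ) ^ s * smoothNorm n f * ((b : ℝ) ^ dickWeight A)⁻¹ := by
  have hb0 : (0 : ℝ) < b := by exact_mod_cast hb
  have hweak : ∀ τ : Fin s → ℕ, (∀ k, τ k ≤ n) → IsWeakDeriv τ f (weakDeriv τ f) := by
    intro τ hτ
    rw [weakDeriv, dif_pos (hf.2 τ hτ)]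
    exact (hf.2 τ hτ).choose_spec
  have : IsFiniteMeasure ((volume : Measure (Fin s → ℝ)).restrict (openCube (Fin s))) := by
    rw [restrict_openCube]; infer_instance
  rw [fourierCoeff_discretization (hf.1.integrable (by norm_num)),
    (hweak 0 fun _ => Nat.zero_le n).tensorIntegral_eq hf.1 fun k => memLp_walsh (A k)]
  have := norm_tensorIntegral_le_of_terminal (G := fun τ => weakDeriv τ f) (B := smoothNorm n f)
    (fun τ hτ => (hweak τ hτ).1)
    (fun τ i hτ hi => (hweak τ hτ).isWeakPartial (hweak _ fun k => by
      by_cases hk : k = i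
      · subst hk; simpa using hi
      · rw [Function.update_of_ne hk]; exact hτ k))
    (fun τ hτ u hu => norm_tensorIntegral_le_smoothNorm hτ (hweak τ hτ).1 hu)
    (fun k => memLp_walsh (A k))
    (M := fun k => (2 * b : ℝ) ^ n * ((b : ℝ) ^ rowWeight (A k))⁻¹) (fun k => by positivity)
    (fun k r hr => norm_mean_iterate_centeredPrimitive_walsh_le hb (A k) hr.le)
    (fun k x hx => norm_iterate_centeredPrimitive_walsh_le hb (A k) (rowCount_le _) le_rfl
      ⟨hx.1.le, hx.2.le⟩)
  refine this.trans_eq ?_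
  simp only [← mul_assoc]
  rw [Finset.prod_mul_distrib, Finset.prod_const, Finset.card_univ, Fintype.card_fin,
    Finset.prod_inv_distrib, Finset.prod_pow_eq_pow_sum, dickWeight_eq_sum]
  ring

end SobolevBound

/-! ### Classical mixed partial derivatives in base two -/

section Classical

variable {s : ℕ}

lemma cubePartial_zero (f : (Fin s → ℝ) → ℝ) : cubePartial 0 f = f := by
  rw [cubePartial]
  induction List.finRange s with
  | nil => rfl
  | cons i l ih => rw [List.foldr_cons, ih]; rfl

/-- One more derivative in the direction `i` is applied to `f^{(N)}` from outside as long as no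
derivative in an earlier direction has been taken. -/
lemma cubePartial_update {N : Fin s → ℕ} {i : Fin s} (hN : ∀ j < i, N j = 0)
    (f : (Fin s → ℝ) → ℝ) :
    cubePartial (Function.update N i (N i + 1)) f = fun x =>
      derivWithin (fun t => cubePartial N f (Function.update x i t)) (Set.Icc 0 1) (x i) := by
  have hcongr : ∀ (l : List (Fin s)) (N N' : Fin s → ℕ), (∀ j ∈ l, N j = N' j) →
      l.foldr (fun i g => (fun (u : (Fin s → ℝ) → ℝ) x =>
        derivWithin (fun t => u (Function.update x i t)) (Set.Icc 0 1) (x i))^[N i] g) f =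
      l.foldr (fun i g => (fun (u : (Fin s → ℝ) → ℝ) x =>
        derivWithin (fun t => u (Function.update x i t)) (Set.Icc 0 1) (x i))^[N' i] g) f := by
    intro l N N' h
    induction l with
    | nil => rfl
    | cons a l ih =>
      rw [List.foldr_cons, List.foldr_cons, ih fun j hj => h j (List.mem_cons_of_mem _ hj),
        h a List.mem_cons_self]
  have key : ∀ l : List (Fin s), l.Pairwise (· < ·) → i ∈ l →
      l.foldr (fun k g => (fun (u : (Fin s → ℝ) → ℝ) x =>
        derivWithin (fun t => u (Function.update x k t)) (Set.Icc 0 1) (x k))^[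
          Function.update N i (N i + 1) k] g) f = fun x =>
      derivWithin (fun t => l.foldr (fun k g => (fun (u : (Fin s → ℝ) → ℝ) x =>
        derivWithin (fun t => u (Function.update x k t)) (Set.Icc 0 1) (x k))^[N k] g) f
          (Function.update x i t)) (Set.Icc 0 1) (x i) := by
    intro l hl hi
    induction l with
    | nil => simp at hi
    | cons a l ih =>
      rw [List.pairwise_cons] at hl
      simp only [List.foldr_cons]
      by_cases ha : a = i
      · subst ha
        rw [hcongr l (Function.update N a (N a + 1)) N fun j hj => by
          rw [Function.update_of_ne (hl.1 j hj).ne'], Function.update_self,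
          Function.iterate_succ_apply']
      · have hil : i ∈ l := by
          rcases List.mem_cons.mp hi with h | h
          · exact absurd h.symm ha
          · exact h
        have hNa := hN a (hl.1 i hil)
        rw [Function.update_of_ne ha, hNa]
        exact ih hl.2 hil
  exact key (List.finRange s) (List.pairwise_lt_finRange s) (List.mem_finRange i)

lemma memLp_of_continuousOn {g : (Fin s → ℝ) → ℝ} (hg : ContinuousOn g (Set.Icc 0 1)) :
    MemLp g 2 (volume.restrict (openCube (Fin s))) := by
  have : IsFiniteMeasure ((volume : Measure (Fin s → ℝ)).restrict (openCube (Fin s))) := by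
    rw [restrict_openCube]; infer_instance
  have hsub : openCube (Fin s) ⊆ Set.Icc 0 1 := fun x hx =>
    ⟨fun k => (hx k (Set.mem_univ k)).1.le, fun k => (hx k (Set.mem_univ k)).2.le⟩
  have hm : MeasurableSet (openCube (Fin s)) := MeasurableSet.univ_pi fun _ => measurableSet_Ioo
  obtain ⟨C, hC⟩ := isCompact_Icc.exists_bound_of_continuousOn hg
  exact MemLp.of_bound ((hg.mono hsub).aestronglyMeasurable hm) C
    ((ae_restrict_mem hm).mono fun x hx => hC x (hsub hx))

/-- A continuous classical partial derivative is a weak partial derivative. -/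
lemma isWeakPartial_of_hasDerivWithinAt {g g' : (Fin s → ℝ) → ℝ} {i : Fin s}
    (hg : ContinuousOn g (Set.Icc 0 1)) (hg' : ContinuousOn g' (Set.Icc 0 1))
    (hderiv : ∀ x ∈ Set.Icc (0 : Fin s → ℝ) 1,
      HasDerivWithinAt (fun t => g (Function.update x i t)) (g' x) (Set.Icc 0 1) (x i)) :
    IsWeakPartial i g g' := by
  intro φ hφ
  have hint : ∀ {h : (Fin s → ℝ) → ℝ}, ContinuousOn h (Set.Icc 0 1) → ∀ {ψ : Fin s → ℝ → ℝ},
      (∀ k, IsTest (ψ k)) →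
      Integrable (fun x => h x * ∏ k, ψ k (x k)) (volume.restrict (openCube (Fin s))) := by
    intro h hh ψ hψ
    have := (integrable_tensor (memLp_of_continuousOn hh) fun k => (hψ k).memLp).re
    refine this.congr (Filter.Eventually.of_forall fun x => ?_)
    simp only [← Complex.ofReal_prod, ← Complex.ofReal_mul]
    exact Complex.ofReal_re _
  have hI1 := hint hg (isTest_update hφ i (hφ i).deriv)
  have hI2 := hint hg' hφ
  rw [← add_eq_zero_iff_eq_neg, ← integral_add hI1 hI2]
  have hI := hI1.add hI2
  rw [restrict_openCube] at hI ⊢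
  obtain _ | m := s
  · exact i.elim0
  have hmp := (measurePreserving_piFinSuccAbove (fun _ : Fin (m + 1) => unitMeasure) i).symm
  rw [← hmp.integral_comp' (fun x => g x * ∏ k, Function.update φ i (deriv (φ i)) k (x k) +
    g' x * ∏ k, φ k (x k))]
  have hIc := hmp.integrable_comp_of_integrable hI
  refine (integral_prod_symm _ hIc).trans ?_
  refine integral_eq_zero_of_ae ?_
  have hy : ∀ᵐ y : Fin m → ℝ ∂(Measure.pi fun _ => unitMeasure), ∀ k, y k ∈ Set.Ioo (0 : ℝ) 1 := by
    rw [ae_all_iff]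
    intro k
    exact Measure.tendsto_eval_ae_ae (ae_restrict_mem measurableSet_Ioo)
  filter_upwards [hy] with y hy
  set P : ℝ := ∏ j : Fin m, φ (i.succAbove j) (y j) with hP
  set X : ℝ → Fin (m + 1) → ℝ := fun t => i.insertNth t y with hX
  have hXmem : ∀ t ∈ Set.Icc (0 : ℝ) 1, X t ∈ Set.Icc (0 : Fin (m + 1) → ℝ) 1 := by
    intro t ht
    constructor <;> intro k <;> induction k using Fin.succAboveCases i with
    | x => simp [hX, ht.1, ht.2]
    | p j => simp [hX, (hy j).1.le, (hy j).2.le]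
  have hXc : Continuous X := Continuous.finInsertNth i continuous_id continuous_const
  have hgX : ContinuousOn (fun t => g (X t)) (Set.Icc 0 1) := hg.comp hXc.continuousOn hXmem
  have hgX' : ContinuousOn (fun t => g' (X t)) (Set.Icc 0 1) := hg'.comp hXc.continuousOn hXmem
  have hφc : Continuous (φ i) := (hφ i).1.continuous
  have hφc' : Continuous (deriv (φ i)) := (hφ i).deriv.1.continuous
  have hFTC := intervalIntegral.integral_eq_sub_of_hasDerivAt_of_le (a := (0 : ℝ)) (b := 1)
    (f := fun t => g (X t) * φ i t) (f' := fun t => g' (X t) * φ i t + g (X t) * deriv (φ i) t)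
    zero_le_one (hgX.mul hφc.continuousOn) (fun t ht => by
      have h1 := hderiv (X t) (hXmem t ⟨ht.1.le, ht.2.le⟩)
      have h2 : (fun t' => g (Function.update (X t) i t')) = fun t' => g (X t') := by
        ext t'; simp [hX]
      have h3 : X t i = t := by simp [hX]
      rw [h2, h3] at h1
      exact (h1.hasDerivAt (Icc_mem_nhds ht.1 ht.2)).mul
        ((hφ i).1.differentiable (by simp) t).hasDerivAt)
    (((hgX'.mul hφc.continuousOn).add (hgX.mul hφc'.continuousOn)).intervalIntegrable_of_Icc
      zero_le_one)
  have hb : ∀ t, t ∉ Set.Ioo (0 : ℝ) 1 → φ i t = 0 := fun t ht =>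
    image_eq_zero_of_notMem_tsupport fun h => ht ((hφ i).2.2 h)
  rw [hb 0 (by simp), hb 1 (by simp), mul_zero, mul_zero, sub_zero,
    intervalIntegral.integral_of_le zero_le_one, integral_Ioc_eq_integral_Ioo] at hFTC
  have hfun : ∀ t, g (X t) * ∏ k, Function.update φ i (deriv (φ i)) k (X t k) +
      g' (X t) * ∏ k, φ k (X t k) =
      (g' (X t) * φ i t + g (X t) * deriv (φ i) t) * P := by
    intro t
    rw [Fin.prod_univ_succAbove _ i, Fin.prod_univ_succAbove _ i]
    simp only [Function.update_self, hX, Fin.insertNth_apply_same, Fin.insertNth_apply_succAbove,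
      Function.update_of_ne (Fin.succAbove_ne i _)]
    rw [← hP]; ring
  calc _ = ∫ t, (g' (X t) * φ i t + g (X t) * deriv (φ i) t) * P ∂unitMeasure := by
        congr 1; ext t; exact hfun t
    _ = 0 := by rw [integral_mul_const, hFTC, zero_mul]

variable {n : ℕ} {f : (Fin s → ℝ) → ℝ}

lemma HasContMixedPartials.isWeakPartial (hf : HasContMixedPartials n f) {N : Fin s → ℕ}
    (hN : ∀ k, N k ≤ n) {i : Fin s} (hi : N i < n) (h0 : ∀ j < i, N j = 0) :
    IsWeakPartial i (cubePartial N f) (cubePartial (Function.update N i (N i + 1)) f) := by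
  refine isWeakPartial_of_hasDerivWithinAt (hf N hN).1 (hf _ fun k => ?_).1 fun x hx => ?_
  · by_cases hk : k = i
    · subst hk; simpa using hi
    · rw [Function.update_of_ne hk]; exact hN k
  · rw [cubePartial_update h0]
    exact ((hf N hN).2 i hi h0 x hx).hasDerivWithinAt

/-- Integration by parts in the direction `i` as long as the iterated primitives have mean zero. -/
lemma HasContMixedPartials.norm_tensorIntegral_eq (hf : HasContMixedPartials n f) {N : Fin s → ℕ}
    (hN : ∀ k, N k ≤ n) {i : Fin s} (hi : N i = 0) (h0 : ∀ j < i, N j = 0)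
    {u : Fin s → ℝ → ℂ} (hu : ∀ k, MemLp (u k) 2 unitMeasure) {R : ℕ} (hR : R ≤ n)
    (hmean : ∀ r < R, mean (centeredPrimitive^[r] (u i)) = 0) :
    ‖tensorIntegral (cubePartial N f) u‖ =
      ‖tensorIntegral (cubePartial (Function.update N i R) f)
        (Function.update u i (centeredPrimitive^[R] (u i)))‖ := by
  have hle : ∀ r ≤ n, ∀ k, Function.update N i r k ≤ n := by
    intro r hr k
    by_cases hk : k = i
    · subst hk; simpa using hr
    · rw [Function.update_of_ne hk]; exact hN k
  induction R with
  | zero =>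
    have h : Function.update N i 0 = N := by rw [← hi, Function.update_eq_self]
    simp [h]
  | succ R ih =>
    have hw := hf.isWeakPartial (hle R (by omega)) (i := i) (by rw [Function.update_self]; omega)
      (fun j hj => by rw [Function.update_of_ne hj.ne]; exact h0 j hj)
    have hstep := hw.tensorIntegral_eq (memLp_of_continuousOn (hf _ (hle R (by omega))).1)
      (memLp_of_continuousOn (hf _ (by
        rw [Function.update_self, Function.update_idem]; exact hle _ hR)).1)
      (memLp_update hu i (memLp_iterate_centeredPrimitive (hu i) R))
    simp only [Function.update_self, Function.update_idem] at hstep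
    rw [ih (by omega) fun r hr => hmean r (by omega), hstep, hmean R (by omega), zero_mul, zero_sub,
      norm_neg, Function.iterate_succ_apply']

lemma abs_cubePartial_le (hf : HasContMixedPartials n f) {N : Fin s → ℕ} (hN : ∀ k, N k ≤ n)
    (hN0 : N ≠ 0) {x : Fin s → ℝ} (hx : x ∈ Set.Icc (0 : Fin s → ℝ) 1) :
    |cubePartial N f x| ≤ maxPartialNorm n f := by
  obtain ⟨C, hC⟩ := isCompact_Icc.exists_bound_of_continuousOn (hf N hN).1
  have h1 : |cubePartial N f x| ≤ supNorm (cubePartial N f) :=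
    le_ciSup (f := fun y : Set.Icc (0 : Fin s → ℝ) 1 => |cubePartial N f y|)
      ⟨C, by rintro _ ⟨y, rfl⟩; exact hC y y.2⟩ ⟨x, hx⟩
  let N' : {N : Fin s → Fin (n + 1) // N ≠ 0} :=
    ⟨fun k => ⟨N k, Nat.lt_succ_of_le (hN k)⟩, fun h => hN0 (by
      ext k
      have := congrArg Fin.val (congrFun h k)
      simpa using this)⟩
  refine h1.trans (le_ciSup (f := fun N : {N : Fin s → Fin (n + 1) // N ≠ 0} =>
    supNorm (cubePartial (fun i => (N.1 i : ℕ)) f)) (Set.finite_range _).bddAbove N')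

lemma maxPartialNorm_nonneg : 0 ≤ maxPartialNorm n f :=
  Real.iSup_nonneg fun _ => Real.iSup_nonneg fun _ => abs_nonneg _

lemma norm_tensorIntegral_le_of_abs_le {g : (Fin s → ℝ) → ℝ} {C : ℝ}
    (hC : ∀ x ∈ Set.Icc (0 : Fin s → ℝ) 1, |g x| ≤ C)
    {u : Fin s → ℝ → ℂ} (hu : ∀ k, MemLp (u k) 2 unitMeasure) :
    ‖tensorIntegral g u‖ ≤ C * ∏ k, ∫ t in (0 : ℝ)..1, ‖u k t‖ := by
  have hprod : ∏ k, ∫ t in (0 : ℝ)..1, ‖u k t‖ =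
      ∫ x in openCube (Fin s), ∏ k, ‖u k (x k)‖ := by
    rw [restrict_openCube, integral_fintype_prod_eq_prod (f := fun k t => ‖u k t‖)]
    refine Finset.prod_congr rfl fun k _ => ?_
    rw [intervalIntegral.integral_of_le zero_le_one, integral_Ioc_eq_integral_Ioo]
  rw [hprod, ← integral_const_mul, tensorIntegral]
  have hm : MeasurableSet (openCube (Fin s)) := MeasurableSet.univ_pi fun _ => measurableSet_Ioo
  refine norm_integral_le_of_norm_le ?_ ((ae_restrict_mem hm).mono fun x hx => ?_)
  · rw [restrict_openCube]
    exact (Integrable.fintype_prod (f := fun k t => ‖u k t‖) fun k =>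
      ((hu k).integrable (by norm_num)).norm).const_mul C
  · rw [norm_mul, norm_prod, Complex.norm_real, Real.norm_eq_abs]
    refine mul_le_mul_of_nonneg_right (hC x ?_) (Finset.prod_nonneg fun _ _ => norm_nonneg _)
    exact ⟨fun k => (hx k (Set.mem_univ k)).1.le, fun k => (hx k (Set.mem_univ k)).2.le⟩

/-- In base two, the nonzero Walsh coefficients of a function with continuous mixed partial
derivatives decay with the sum of the Dick and Hamming weights, with constant one. -/
lemma norm_fourierCoeff_le_of_base_two {b : ℕ} [NeZero b] (hb : b = 2)
    (hf : HasContMixedPartials n f) {A : DigitMatrix b s n} (hA : A ≠ 0) :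
    ‖fourierCoeff (discretization f) A‖ ≤
      maxPartialNorm n f * ((b : ℝ) ^ (dickWeight A + hammingWeight A))⁻¹ := by
  have hfin : IsFiniteMeasure ((volume : Measure (Fin s → ℝ)).restrict (openCube (Fin s))) := by
    rw [restrict_openCube]; infer_instance
  have hfm : MemLp f 2 (volume.restrict (openCube (Fin s))) := by
    have := (hf 0 fun _ => Nat.zero_le n).1
    rw [cubePartial_zero] at this
    exact memLp_of_continuousOn this
  rw [fourierCoeff_discretization (hfm.integrable (by norm_num))]
  -- the coordinates are treated from the last to the first
  have key : ∀ k ≤ s, ‖tensorIntegral f fun i => walsh (A i)‖ =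
      ‖tensorIntegral (cubePartial (fun i => if k ≤ (i : ℕ) then rowCount (A i) else 0) f)
        fun i => if k ≤ (i : ℕ) then centeredPrimitive^[rowCount (A i)] (walsh (A i))
          else walsh (A i)‖ := by
    intro k hk
    induction hk using Nat.decreasingInduction with
    | self =>
      have h1 : (fun i : Fin s => if s ≤ (i : ℕ) then rowCount (A i) else 0) = 0 := by
        ext i; simp
      have h2 : (fun i : Fin s => if s ≤ (i : ℕ) then
          centeredPrimitive^[rowCount (A i)] (walsh (A i)) else walsh (A i)) =
          fun i => walsh (A i) :=
        funext fun i => if_neg (not_le.mpr i.2)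
      rw [h1, h2, cubePartial_zero]
    | of_succ k hk ih =>
      rw [ih]
      set i : Fin s := ⟨k, hk⟩ with hi
      rw [hf.norm_tensorIntegral_eq (i := i) (R := rowCount (A i)) ?hN ?hi ?h0 ?hu
        (rowCount_le _) ?hmean]
      · congr 3
        · ext j
          by_cases hj : j = i
          · subst hj; simp [hi]
          · rw [Function.update_of_ne hj]
            have : (j : ℕ) ≠ k := fun h => hj (Fin.ext h)
            congr 1
            exact propext (by omega)
        · ext j
          by_cases hj : j = i
          · subst hj; simp [hi]
          · rw [Function.update_of_ne hj]
            have : (j : ℕ) ≠ k := fun h => hj (Fin.ext h)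
            have h2 : (k + 1 ≤ (j : ℕ)) = (k ≤ (j : ℕ)) := propext (by omega)
            simp only [h2]
      case hmean =>
        intro r hr
        have hni : ¬ k + 1 ≤ (i : ℕ) := by simp [hi]
        rw [if_neg hni]
        exact (iterate_centeredPrimitive_walsh (A i)).1 r hr
      case hN =>
        intro j; split_ifs
        · exact rowCount_le _
        · exact Nat.zero_le _
      case hi => simp [hi]
      case h0 =>
        intro j hj
        have : ¬ k + 1 ≤ (j : ℕ) := by
          have : (j : ℕ) < k := hj
          omega
        simp [this]
      case hu =>
        intro j; split_ifs
        · exact memLp_iterate_centeredPrimitive (memLp_walsh _) _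
        · exact memLp_walsh _
  rw [key 0 (Nat.zero_le s)]
  simp only [Nat.zero_le, if_true]
  have hN0 : (fun i => rowCount (A i)) ≠ 0 := by
    intro h
    apply hA
    ext i j
    have h1 := congrFun h i
    simp only [rowCount, Pi.zero_apply, Finset.sum_eq_zero_iff, Finset.mem_univ, true_imp_iff] at h1
    have := h1 j
    change A i j = 0
    by_contra hne
    rw [if_neg hne] at this
    exact one_ne_zero this
  refine (norm_tensorIntegral_le_of_abs_le
    (fun x hx => abs_cubePartial_le hf (fun i => rowCount_le (A i)) hN0 hx)
    fun k => memLp_iterate_centeredPrimitive (memLp_walsh (A k)) _).trans ?_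
  refine mul_le_mul_of_nonneg_left ?_ maxPartialNorm_nonneg
  refine (Finset.prod_le_prod (fun k _ => intervalIntegral.integral_nonneg zero_le_one
    fun _ _ => norm_nonneg _) fun k _ => (iterate_centeredPrimitive_walsh (A k)).2.2 hb).trans_eq ?_
  rw [Finset.prod_inv_distrib, Finset.prod_pow_eq_pow_sum, dickWeight_eq_sum, hammingWeight_eq_sum,
    Finset.sum_add_distrib]

end Classical

end DigitalNet

end

theorem theorem3 (b s n : ℕ) [NeZero b] (hb : 2 ≤ b) (hs : 1 ≤ s) (hn : 1 ≤ n) :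
    (∃ C : ℝ,
      (∀ f : (Fin s → ℝ) → ℝ, DigitalNet.IsNSmooth n f →
        ∀ A : DigitalNet.DigitMatrix b s n,
          ‖DigitalNet.fourierCoeff (DigitalNet.discretization f) A‖ ≤
            C * DigitalNet.smoothNorm n f * ((b : ℝ) ^ DigitalNet.dickWeight A)⁻¹) ∧
      (∀ f : (Fin s → ℝ) → ℝ, DigitalNet.IsNSmooth n f →
        ∀ P : AddSubgroup (DigitalNet.DigitMatrix b s n),
          DigitalNet.rmsError P f ≤
            C * DigitalNet.smoothNorm n f *
              DigitalNet.walshMerit P DigitalNet.dickWeight)) ∧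
    (b = 2 →
      ∀ f : (Fin s → ℝ) → ℝ, DigitalNet.HasContMixedPartials n f →
        ∀ P : AddSubgroup (DigitalNet.DigitMatrix b s n),
          DigitalNet.rmsError P f ≤
            DigitalNet.maxPartialNorm n f *
              DigitalNet.walshMerit P
                (fun A => DigitalNet.dickWeight A + DigitalNet.hammingWeight A)) := by
  have hb1 : 1 ≤ b := by omega
  refine ⟨⟨((n + 1) * (2 * b) ^ n : ℝ) ^ s, ?_, ?_⟩, ?_⟩
  · exact fun f hf A => DigitalNet.norm_fourierCoeff_le hb1 hf A
  · exact fun f hf P => DigitalNet.rmsError_le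
      (mul_nonneg (by positivity) (Real.sqrt_nonneg _))
      fun A _ => DigitalNet.norm_fourierCoeff_le hb1 hf A
  · exact fun hb2 f hf P => DigitalNet.rmsError_le DigitalNet.maxPartialNorm_nonneg
      fun A hA => DigitalNet.norm_fourierCoeff_le_of_base_two hb2 hf hA
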